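/- Let $d\ge 2$, let $\mathbb M$ be a complete separable metric space with its Borel $\sigma$-field, let $\mathbb Q$ be a probability measure on $\mathbb M$, and let $\lambda_d$ be Lebesgue measure on $\mathbb R^d$. Let $\varphi\colon(\mathbb R^d\times\mathbb M)^2\to[0,1]$ be measurable, symmetric and translation invariant in the locations, that is, $\varphi((x,p),(y,q))=\varphi((0,p),(y-x,q))$; write $\varphi(x,p,q):=\varphi((0,p),(x,q))$. For $t\ge 0$ let $\eta$ be a Poisson process on $\mathbb R^d\times\mathbb M$ with intensity measure $t\,\lambda_d\otimes\mathbb Q$. For $v\in\mathbb R^d\times\mathbb M$ let $\xi^v$ be the random graph with vertex set $\eta\cup\{v\}$ in which any two distinct vertices $a,b$ are joined by an edge with probability $\varphi(a,b)$, independently for different pairs, and let $C^v$ be the connected component of $v$ in $\xi^v$, with $|C^v|$ its number of vertices. Define the critical intensity $$t_c:=\sup\{t\ge 0:\ \mathbb P_t(|C^v|<\infty)=1\ \text{for } \lambda_d\otimes\mathbb Q\text{-a.e. } v\}\in[0,\infty].$$ (a) Suppose that there are a Borel set $A\subset\mathbb M$ with $\mathbb Q(A)>0$ and a measurable function $\varphi_0\colon\mathbb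 R^d\to[0,1]$ with $\varphi_0(-x)=\varphi_0(x)$ for all $x$ and $\int\varphi_0(x)\,dx\in(0,\infty)$ such that $\varphi(x,p,q)\ge\varphi_0(x)$ for $\lambda_d\otimes\mathbb Q^2$-a.e. $(x,p,q)\in\mathbb R^d\times A\times A$. Then $t_c<\infty$. (b) Let $d_\varphi(p,q):=\int\varphi(x,p,q)\,dx$ and $\|d_\varphi\|_{1,1}:=\iint d_\varphi(p,q)\,\mathbb Q(dp)\,\mathbb Q(dq)$. If $\|d_\varphi\|_{1,1}\in(0,\infty)$, then $t_c<\infty$. -/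

import Mathlib

open MeasureTheory ProbabilityTheory
open scoped NNReal ENNReal

namespace MarkedRCM

/-- The state space `ℝ^d × M`: a location together with a mark. -/
abbrev Space (d : ℕ) (M : Type*) : Type _ := EuclideanSpace ℝ (Fin d) × M

/-- A connection function: a measurable symmetric function `(ℝ^d × M)² → [0,1]` which is
translation invariant in the locations. -/
structure ConnectionFunction (d : ℕ) (M : Type*) [MeasurableSpace M] where
  /-- the probability of an edge between two points -/
  toFun : Space d M → Space d M → ℝ
  measurable : Measurable (Function.uncurry toFun)
  nonneg : ∀ a b, 0 ≤ toFun a b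
  le_one : ∀ a b, toFun a b ≤ 1
  symm : ∀ a b, toFun a b = toFun b a
  translation : ∀ (x y : EuclideanSpace ℝ (Fin d)) (p q : M),
    toFun (x, p) (y, q) = toFun (0, p) (y - x, q)

/-- Names for the (potential) points of the Poisson process: `(z, j)` is the `j`-th point in the
unit cube with lower corner `z ∈ ℤ^d`. -/
abbrev Label (d : ℕ) : Type := (Fin d → ℤ) × ℕ

/-- The sample space. The first component gives the number of Poisson points in each unit cube
`z + [0,1]^d`, the second one the relative position in its cube and the mark of each potential
point, and the third one a `[0,1]`-valued variable for each (unordered) pair of potential points;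
`none` is the name of an additional deterministic vertex. -/
abbrev Sample (d : ℕ) (M : Type*) : Type _ :=
  ((Fin d → ℤ) → ℕ) × (Label d → (Fin d → unitInterval) × M) ×
    (Sym2 (Option (Label d)) → unitInterval)

/-- The law `P_t`. All variables are independent: the numbers of points in the cubes are Poisson
distributed with mean `t`, relative positions are uniform on the unit cube, marks have law `Q`,
and the edge variables are uniform on `[0,1]`. Consequently the points that are present form a
Poisson process with intensity measure `t • (Lebesgue ⊗ Q)`. -/
noncomputable def law (d : ℕ) {M : Type*} [MeasurableSpace M] (Q : Measure M)
    [IsProbabilityMeasure Q] (t : ℝ≥0) : Measure (Sample d M) :=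
  (Measure.infinitePi fun _ : Fin d → ℤ => poissonMeasure t).prod
    ((Measure.infinitePi fun _ : Label d =>
        (volume : Measure (Fin d → unitInterval)).prod Q).prod
      (Measure.infinitePi fun _ : Sym2 (Option (Label d)) => (volume : Measure unitInterval)))

section

variable {d : ℕ} {M : Type*}

/-- The location and the mark of the vertex named `a`, the extra vertex being `v`. -/
noncomputable def point (v : Space d M) (ω : Sample d M) : Option (Label d) → Space d M
  | none => v
  | some (z, j) =>
      (WithLp.toLp 2 fun i => (z i : ℝ) + ((ω.2.1 (z, j)).1 i : ℝ), (ω.2.1 (z, j)).2)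

/-- The vertices that are present: the extra vertex, and the first `N_z` potential points of each
cube `z`, where `N_z` is the number of Poisson points in that cube. -/
def IsVertex (ω : Sample d M) : Option (Label d) → Prop
  | none => True
  | some (z, j) => j < ω.1 z

variable [MeasurableSpace M]

/-- The random connection model `ξ^v` based on the Poisson process augmented by the vertex `v`:
distinct vertices `a, b` that are present are joined when their edge variable is at most the
value of the connection function, hence with conditional probability `φ(a, b)`, independently for
different pairs. -/
def graph (φ : ConnectionFunction d M) (v : Space d M) (ω : Sample d M) :
    SimpleGraph (Option (Label d)) where
  Adj a b := a ≠ b ∧ IsVertex ω a ∧ IsVertex ω b ∧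
    (ω.2.2 s(a, b) : ℝ) ≤ φ.toFun (point v ω a) (point v ω b)
  symm := ⟨fun a b h => ⟨h.1.symm, h.2.2.1, h.2.1, by
    rw [Sym2.eq_swap, φ.symm]; exact h.2.2.2⟩⟩
  loopless := ⟨fun _ h => h.1 rfl⟩

/-- The vertex set of the cluster `C^v` of `v` in `ξ^v`. -/
def cluster (φ : ConnectionFunction d M) (v : Space d M) (ω : Sample d M) :
    Set (Option (Label d)) :=
  {a | (graph φ v ω).Reachable none a}

/-- The intensity `t` is subcritical: `P_t(|C^v| < ∞) = 1` for almost every `v`. -/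
def IsSubcritical (φ : ConnectionFunction d M) (Q : Measure M) [IsProbabilityMeasure Q]
    (t : ℝ≥0) : Prop :=
  ∀ᵐ v ∂((volume : Measure (EuclideanSpace ℝ (Fin d))).prod Q),
    ∀ᵐ ω ∂(law d Q t), (cluster φ v ω).Finite

/-- The critical intensity `t_c ∈ [0,∞]`, the supremum of all subcritical intensities. -/
noncomputable def criticalIntensity (φ : ConnectionFunction d M) (Q : Measure M)
    [IsProbabilityMeasure Q] : ℝ≥0∞ :=
  ⨆ (t : ℝ≥0) (_ : IsSubcritical φ Q t), (t : ℝ≥0∞)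

/-- `d_φ(p, q) = ∫ φ((0, p), (x, q)) dx`. -/
noncomputable def dphi (φ : ConnectionFunction d M) (p q : M) : ℝ≥0∞ :=
  ∫⁻ x : EuclideanSpace ℝ (Fin d), ENNReal.ofReal (φ.toFun (0, p) (x, q))

/-- The mixed norm `‖L‖_{r₁,r₂} = (∫ (∫ L(p, q)^{r₁} Q(dp))^{r₂/r₁} Q(dq))^{1/r₂}` of a function
`L : M² → [0,∞]`, for `r₁, r₂ ∈ [1,∞)`. -/
noncomputable def mixedNorm (Q : Measure M) (r₁ r₂ : ℝ) (L : M → M → ℝ≥0∞) : ℝ≥0∞ :=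
  (∫⁻ q, (∫⁻ p, L p q ^ r₁ ∂Q) ^ (r₂ / r₁) ∂Q) ^ (1 / r₂)

end

end MarkedRCM

/-! Both parts reduce to one statement: if `φ` does not vanish almost everywhere, then no
sufficiently large intensity is subcritical, so the supremum is finite. Each hypothesis is used only
to exclude that `φ` vanishes almost everywhere.

Direct edges cannot be controlled uniformly, since `φ` is only measurable; common neighbours can.
View `φ((0,p), ·)`, cut off at radius `R`, as an element of `L²`. Since `L²` is separable, some set
`A` of marks of positive measure gives functions of norm above `10κ`, all within `κ` of one `g`.
Translation is continuous in `L²`, so for marks in `A` and locations closer than `ρ` the inner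
product of the two functions is at least `κ²`. This bounds below the expected number of common
neighbours per unit of intensity (`exists_two_step`).

Then discretise. Cells of side `1/K` along the first two coordinates form a copy of `ℤ²`. In each
unit cube the first `m` labels serve as candidates and the next `m` as connectors. A site is good if
the cubes around it hold at least `2m` points, some candidate lies over it with mark in `A`, and
each of its candidates shares a connector with each candidate of the right and upper neighbours.
Taking `m` large and then `t` large makes bad sites as rare as desired
(`exists_measure_badSite_le`). Their dependence has finite range `L`.

Percolation of good sites is proved by a multiscale recursion. A box of `(2L+1)²` cells is bad if it
has two bad cells at distance at least `L`; distant cells are independent, so the probability of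
badness is essentially squared at every level (`measure_badBox_le`). Deterministically, good boxes
contain connected cores that join those of adjacent good boxes (`core_connected`). Hence some
labelled point lies in an infinite component with positive probability.

Finally, the edge variable between the extra vertex and that point is independent of all this. If
`|C^v| < ∞` almost surely for almost every `v`, then `φ(v, ·)` must vanish at that point for almost
every `v`, which contradicts the two-step bound with both points equal. -/

namespace MarkedRCM

/-! ### Deterministic multiscale geometry of good boxes -/

section Hierarchy

variable {L : ℕ} {bad : ℤ × ℤ → Prop}

/-- The sub-cell with offset `(i, j)` of the box `b`, which consists of `(2L+1) × (2L+1)` cells. -/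
def cell (L : ℕ) (b : ℤ × ℤ) (i j : ℕ) : ℤ × ℤ :=
  ((2 * L + 1 : ℤ) * b.1 + i, (2 * L + 1 : ℤ) * b.2 + j)

/-- A box of level `n + 1` is bad if it has two bad sub-cells at sup-distance at least `L`. -/
def BadBox (L : ℕ) (bad : ℤ × ℤ → Prop) : ℕ → ℤ × ℤ → Prop
  | 0, b => bad b
  | n + 1, b => ∃ i < 2 * L + 1, ∃ j < 2 * L + 1, ∃ i' < 2 * L + 1, ∃ j' < 2 * L + 1,
      (i + L ≤ i' ∨ j + L ≤ j') ∧ BadBox L bad n (cell L b i j) ∧ BadBox L bad n (cell L b i' j')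

/-- All cells of column `i` of the box `b` are good. -/
def GoodCol (L : ℕ) (bad : ℤ × ℤ → Prop) (n : ℕ) (b : ℤ × ℤ) (i : ℕ) : Prop :=
  ∀ j < 2 * L + 1, ¬ BadBox L bad n (cell L b i j)

/-- All cells of row `j` of the box `b` are good. -/
def GoodRow (L : ℕ) (bad : ℤ × ℤ → Prop) (n : ℕ) (b : ℤ × ℤ) (j : ℕ) : Prop :=
  ∀ i < 2 * L + 1, ¬ BadBox L bad n (cell L b i j)

/-- The sites of a box that are reached through good rows and columns at all levels. -/
def core (L : ℕ) (bad : ℤ × ℤ → Prop) : ℕ → ℤ × ℤ → Set (ℤ × ℤ)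
  | 0, b => {b}
  | n + 1, b => {x | ∃ i < 2 * L + 1, ∃ j < 2 * L + 1,
      (GoodCol L bad n b i ∨ GoodRow L bad n b j) ∧ x ∈ core L bad n (cell L b i j)}

/-- Rows `0`, `L` and `2L` are pairwise at distance at least `L`, so a box that is not bad has a bad
cell in at most one of them. Two boxes together spoil at most two of the three rows. This is the
reason for the side length `2L+1`. -/
lemma exists_common_goodRow {n : ℕ} {b b' : ℤ × ℤ} (hb : ¬ BadBox L bad (n + 1) b)
    (hb' : ¬ BadBox L bad (n + 1) b') :
    ∃ j < 2 * L + 1, GoodRow L bad n b j ∧ GoodRow L bad n b' j := by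
  have key : ∀ {b : ℤ × ℤ}, ¬ BadBox L bad (n + 1) b → ∀ j j', j + L ≤ j' → j' < 2 * L + 1 →
      GoodRow L bad n b j ∨ GoodRow L bad n b j' := by
    intro b hb j j' hj hj'
    by_contra! h
    simp only [GoodRow] at h
    push Not at h
    obtain ⟨⟨i, hi, h1⟩, i', hi', h2⟩ := h
    exact hb ⟨i, hi, j, by omega, i', hi', j', hj', Or.inr hj, h1, h2⟩
  by_contra! h
  have a1 := key hb 0 L (by omega) (by omega)
  have a2 := key hb 0 (2 * L) (by omega) (by omega)
  have a3 := key hb L (2 * L) (by omega) (by omega)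
  have b1 := key hb' 0 L (by omega) (by omega)
  have b2 := key hb' 0 (2 * L) (by omega) (by omega)
  have b3 := key hb' L (2 * L) (by omega) (by omega)
  have c1 := h 0 (by omega)
  have c2 := h L (by omega)
  have c3 := h (2 * L) (by omega)
  tauto

lemma exists_common_goodCol {n : ℕ} {b b' : ℤ × ℤ} (hb : ¬ BadBox L bad (n + 1) b)
    (hb' : ¬ BadBox L bad (n + 1) b') :
    ∃ i < 2 * L + 1, GoodCol L bad n b i ∧ GoodCol L bad n b' i := by
  have key : ∀ {b : ℤ × ℤ}, ¬ BadBox L bad (n + 1) b → ∀ i i', i + L ≤ i' → i' < 2 * L + 1 →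
      GoodCol L bad n b i ∨ GoodCol L bad n b i' := by
    intro b hb i i' hi hi'
    by_contra! h
    simp only [GoodCol] at h
    push Not at h
    obtain ⟨⟨j, hj, h1⟩, j', hj', h2⟩ := h
    exact hb ⟨i, by omega, j, hj, i', hi', j', hj', Or.inl hi, h1, h2⟩
  by_contra! h
  have a1 := key hb 0 L (by omega) (by omega)
  have a2 := key hb 0 (2 * L) (by omega) (by omega)
  have a3 := key hb L (2 * L) (by omega) (by omega)
  have b1 := key hb' 0 L (by omega) (by omega)
  have b2 := key hb' 0 (2 * L) (by omega) (by omega)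
  have b3 := key hb' L (2 * L) (by omega) (by omega)
  have c1 := h 0 (by omega)
  have c2 := h L (by omega)
  have c3 := h (2 * L) (by omega)
  tauto

lemma core_nonempty (n : ℕ) {b : ℤ × ℤ} (hb : ¬ BadBox L bad n b) :
    (core L bad n b).Nonempty := by
  induction n generalizing b with
  | zero => exact ⟨b, rfl⟩
  | succ n ih =>
    obtain ⟨j, hj, h, -⟩ := exists_common_goodRow hb hb
    obtain ⟨x, hx⟩ := ih (h 0 (by omega))
    exact ⟨x, 0, by omega, j, hj, Or.inr h, hx⟩

lemma not_bad_of_mem_core (n : ℕ) {b x : ℤ × ℤ} (hb : ¬ BadBox L bad n b)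
    (hx : x ∈ core L bad n b) : ¬ bad x := by
  induction n generalizing b with
  | zero => obtain rfl : x = b := hx; exact hb
  | succ n ih =>
    obtain ⟨i, hi, j, hj, h, hx⟩ := hx
    exact ih (h.elim (fun h => h j hj) fun h => h i hi) hx

/-- Applied to the boxes `(1, 0)` of all levels, this shows that the sites reached from the origin
are unbounded. -/
lemma le_fst_of_mem_core (n : ℕ) {b x : ℤ × ℤ} (hx : x ∈ core L bad n b) :
    (2 * L + 1 : ℤ) ^ n * b.1 ≤ x.1 := by
  induction n generalizing b with
  | zero => obtain rfl : x = b := hx; simp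
  | succ n ih =>
    obtain ⟨i, hi, j, hj, h, hx⟩ := hx
    have := ih hx
    have h0 : (0 : ℤ) ≤ (2 * L + 1 : ℤ) ^ n * i := by positivity
    simp only [cell] at this
    rw [mul_add] at this
    rw [pow_succ, mul_assoc]
    linarith

/-- Connectedness inside a box and across its right and upper sides must be proved in one induction:
a box of the next level is connected by walking through adjacent cells along a good row or column,
and adjacent boxes are linked through a row or column that is good in both. The relation `r` is
abstract so that it can later be reachability between Poisson points chosen at the sites. -/
lemma core_connected {r : ℤ × ℤ → ℤ × ℤ → Prop} (hr : Equivalence r)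
    (h1 : ∀ u : ℤ × ℤ, ¬ bad u → ¬ bad (u.1 + 1, u.2) → r u (u.1 + 1, u.2))
    (h2 : ∀ u : ℤ × ℤ, ¬ bad u → ¬ bad (u.1, u.2 + 1) → r u (u.1, u.2 + 1)) (n : ℕ) :
    (∀ b, ¬ BadBox L bad n b → ∀ x ∈ core L bad n b, ∀ y ∈ core L bad n b, r x y) ∧
    (∀ b : ℤ × ℤ, ¬ BadBox L bad n b → ¬ BadBox L bad n (b.1 + 1, b.2) →
      ∀ x ∈ core L bad n b, ∀ y ∈ core L bad n (b.1 + 1, b.2), r x y) ∧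
    (∀ b : ℤ × ℤ, ¬ BadBox L bad n b → ¬ BadBox L bad n (b.1, b.2 + 1) →
      ∀ x ∈ core L bad n b, ∀ y ∈ core L bad n (b.1, b.2 + 1), r x y) := by
  induction n with
  | zero =>
    refine ⟨?_, ?_, ?_⟩
    · rintro b - x rfl y rfl; exact hr.refl _
    · rintro b hb hb' x rfl y rfl; exact h1 _ hb hb'
    · rintro b hb hb' x rfl y rfl; exact h2 _ hb hb'
  | succ n ih =>
    obtain ⟨ih0, ih1, ih2⟩ := ih
    have row : ∀ b j, GoodRow L bad n b j → ∀ i i', i ≤ i' → i' < 2 * L + 1 →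
        ∀ x ∈ core L bad n (cell L b i j), ∀ y ∈ core L bad n (cell L b i' j), r x y := by
      intro b j hg i i' hi
      induction i', hi using Nat.le_induction with
      | base => intro hi x hx y hy; exact ih0 _ (hg i hi) x hx y hy
      | succ k hk ihk =>
        intro hk' x hx y hy
        obtain ⟨z, hz⟩ := core_nonempty n (hg k (by omega))
        have hc : cell L b (k + 1) j = ((cell L b k j).1 + 1, (cell L b k j).2) := by
          simp [cell, add_assoc]
        rw [hc] at hy
        exact hr.trans (ihk (by omega) x hx z hz)
          (ih1 _ (hg k (by omega)) (hc ▸ hg (k + 1) hk') z hz y hy)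
    have col : ∀ b i, GoodCol L bad n b i → ∀ j j', j ≤ j' → j' < 2 * L + 1 →
        ∀ x ∈ core L bad n (cell L b i j), ∀ y ∈ core L bad n (cell L b i j'), r x y := by
      intro b i hg j j' hj
      induction j', hj using Nat.le_induction with
      | base => intro hj x hx y hy; exact ih0 _ (hg j hj) x hx y hy
      | succ k hk ihk =>
        intro hk' x hx y hy
        obtain ⟨z, hz⟩ := core_nonempty n (hg k (by omega))
        have hc : cell L b i (k + 1) = ((cell L b i k).1, (cell L b i k).2 + 1) := by
          simp [cell, add_assoc]
        rw [hc] at hy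
        exact hr.trans (ihk (by omega) x hx z hz)
          (ih2 _ (hg k (by omega)) (hc ▸ hg (k + 1) hk') z hz y hy)
    have row' : ∀ b j, GoodRow L bad n b j → ∀ i < 2 * L + 1, ∀ i' < 2 * L + 1,
        ∀ x ∈ core L bad n (cell L b i j), ∀ y ∈ core L bad n (cell L b i' j), r x y := by
      intro b j hg i hi i' hi' x hx y hy
      rcases le_total i i' with h | h
      · exact row b j hg i i' h hi' x hx y hy
      · exact hr.symm (row b j hg i' i h hi y hy x hx)
    have col' : ∀ b i, GoodCol L bad n b i → ∀ j < 2 * L + 1, ∀ j' < 2 * L + 1,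
        ∀ x ∈ core L bad n (cell L b i j), ∀ y ∈ core L bad n (cell L b i j'), r x y := by
      intro b i hg j hj j' hj' x hx y hy
      rcases le_total j j' with h | h
      · exact col b i hg j j' h hj' x hx y hy
      · exact hr.symm (col b i hg j' j h hj y hy x hx)
    -- The cell where a good column meets a good row serves as a hub: any good column crosses the
    -- row of the hub, and any good row crosses its column.
    have tocross : ∀ b i₀ j₀, i₀ < 2 * L + 1 → j₀ < 2 * L + 1 → GoodCol L bad n b i₀ →
        GoodRow L bad n b j₀ → ∀ x ∈ core L bad (n + 1) b,
        ∀ y ∈ core L bad n (cell L b i₀ j₀), r x y := by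
      rintro b i₀ j₀ hi₀ hj₀ hc hw x ⟨i, hi, j, hj, h | h, hx⟩ y hy
      · obtain ⟨z, hz⟩ := core_nonempty n (hw i hi)
        exact hr.trans (col' b i h j hj j₀ hj₀ x hx z hz) (row' b j₀ hw i hi i₀ hi₀ z hz y hy)
      · obtain ⟨z, hz⟩ := core_nonempty n (hc j hj)
        exact hr.trans (row' b j h i hi i₀ hi₀ x hx z hz) (col' b i₀ hc j hj j₀ hj₀ z hz y hy)
    have conn : ∀ b, ¬ BadBox L bad (n + 1) b → ∀ x ∈ core L bad (n + 1) b,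
        ∀ y ∈ core L bad (n + 1) b, r x y := by
      intro b hb x hx y hy
      obtain ⟨i₀, hi₀, hc, -⟩ := exists_common_goodCol hb hb
      obtain ⟨j₀, hj₀, hw, -⟩ := exists_common_goodRow hb hb
      obtain ⟨z, hz⟩ := core_nonempty n (hw i₀ hi₀)
      exact hr.trans (tocross b i₀ j₀ hi₀ hj₀ hc hw x hx z hz)
        (hr.symm (tocross b i₀ j₀ hi₀ hj₀ hc hw y hy z hz))
    refine ⟨conn, ?_, ?_⟩
    · intro b hb hb' x hx y hy
      obtain ⟨j, hj, hw, hw'⟩ := exists_common_goodRow hb hb'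
      obtain ⟨z, hz⟩ := core_nonempty n (hw (2 * L) (by omega))
      obtain ⟨z', hz'⟩ := core_nonempty n (hw' 0 (by omega))
      have hc : cell L (b.1 + 1, b.2) 0 j
          = ((cell L b (2 * L) j).1 + 1, (cell L b (2 * L) j).2) := by
        simp only [cell, Prod.mk.injEq, and_true]; push_cast; ring
      have hzz' : r z z' := ih1 _ (hw (2 * L) (by omega)) (hc ▸ hw' 0 (by omega)) z hz z' (hc ▸ hz')
      exact hr.trans (conn b hb x hx z ⟨2 * L, by omega, j, hj, Or.inr hw, hz⟩) (hr.trans hzz'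
        (conn _ hb' z' ⟨0, by omega, j, hj, Or.inr hw', hz'⟩ y hy))
    · intro b hb hb' x hx y hy
      obtain ⟨i, hi, hw, hw'⟩ := exists_common_goodCol hb hb'
      obtain ⟨z, hz⟩ := core_nonempty n (hw (2 * L) (by omega))
      obtain ⟨z', hz'⟩ := core_nonempty n (hw' 0 (by omega))
      have hc : cell L (b.1, b.2 + 1) i 0
          = ((cell L b i (2 * L)).1, (cell L b i (2 * L)).2 + 1) := by
        simp only [cell, Prod.mk.injEq, true_and]; push_cast; ring
      have hzz' : r z z' := ih2 _ (hw (2 * L) (by omega)) (hc ▸ hw' 0 (by omega)) z hz z' (hc ▸ hz')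
      exact hr.trans (conn b hb x hx z ⟨i, hi, 2 * L, by omega, Or.inl hw, hz⟩) (hr.trans hzz'
        (conn _ hb' z' ⟨i, hi, 0, by omega, Or.inl hw', hz'⟩ y hy))

/-- If the first rows of all the boxes at the origin are good, then infinitely many good sites
are connected with the origin. -/
lemma infinite_of_forall_not_badBox (hL : 1 ≤ L) {r : ℤ × ℤ → ℤ × ℤ → Prop} (hr : Equivalence r)
    (h1 : ∀ u : ℤ × ℤ, ¬ bad u → ¬ bad (u.1 + 1, u.2) → r u (u.1 + 1, u.2))
    (h2 : ∀ u : ℤ × ℤ, ¬ bad u → ¬ bad (u.1, u.2 + 1) → r u (u.1, u.2 + 1))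
    (h : ∀ n, ∀ i < 2 * L + 1, ¬ BadBox L bad n ((i : ℕ), 0)) :
    {u | ¬ bad u ∧ r 0 u}.Infinite := by
  have hrow : ∀ n, GoodRow L bad n 0 0 := by
    intro n i hi
    simpa [cell] using h n i hi
  -- The corner cell of the box at the origin lies in its bottom row, which is good at every level,
  -- so the origin is never dropped from the core.
  have h0 : ∀ n, (0 : ℤ × ℤ) ∈ core L bad n 0 := by
    intro n
    induction n with
    | zero => rfl
    | succ n ih =>
      have hc : cell L 0 0 0 = 0 := by simp [cell]
      exact ⟨0, by omega, 0, by omega, Or.inr (hrow n), hc ▸ ih⟩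
  have hx : ∀ n : ℕ, ∃ x : ℤ × ℤ, (2 * L + 1 : ℤ) ^ n ≤ x.1 ∧ ¬ bad x ∧ r 0 x := by
    intro n
    have hg : ¬ BadBox L bad n (1, 0) := by simpa using h n 1 (by omega)
    obtain ⟨x, hx⟩ := core_nonempty n hg
    refine ⟨x, by simpa using le_fst_of_mem_core n hx, not_bad_of_mem_core n hg hx, ?_⟩
    exact (core_connected hr h1 h2 n).2.1 0 (h n 0 (by omega)) (by simpa using hg)
      0 (h0 n) x (by simpa using hx)
  intro hfin
  obtain ⟨B, hB⟩ := (hfin.image Prod.fst).bddAbove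
  obtain ⟨n, hn⟩ : ∃ n : ℕ, B < (2 * L + 1 : ℤ) ^ n := by
    obtain ⟨n, hn⟩ := pow_unbounded_of_one_lt B (show (1 : ℤ) < 2 * L + 1 by omega)
    exact ⟨n, hn⟩
  obtain ⟨x, hx, hx'⟩ := hx n
  have := hB ⟨x, hx', rfl⟩
  omega

end Hierarchy

/-! ### Bad boxes are unlikely under finite-range dependence -/

section HierarchyProbability

variable {Ω ι : Type*} {L : ℕ}

lemma setOf_badBox_succ (bad : ℤ × ℤ → Set Ω) (n : ℕ) (b : ℤ × ℤ) :
    {ω | BadBox L (fun u => ω ∈ bad u) (n + 1) b} =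
      ⋃ c ∈ {c ∈ (Finset.range (2 * L + 1) ×ˢ Finset.range (2 * L + 1)) ×ˢ
          (Finset.range (2 * L + 1) ×ˢ Finset.range (2 * L + 1)) |
          c.1.1 + L ≤ c.2.1 ∨ c.1.2 + L ≤ c.2.2},
        {ω | BadBox L (fun u => ω ∈ bad u) n (cell L b c.1.1 c.1.2)} ∩
        {ω | BadBox L (fun u => ω ∈ bad u) n (cell L b c.2.1 c.2.2)} := by
  ext ω
  simp only [BadBox, Set.mem_ofPred_eq, Set.mem_iUnion, Set.mem_inter_iff, Finset.mem_filter,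
    Finset.mem_product, Finset.mem_range, exists_prop, Prod.exists]
  constructor
  · rintro ⟨i, hi, j, hj, i', hi', j', hj', h, h1, h2⟩
    exact ⟨i, j, i', j', ⟨⟨⟨hi, hj⟩, hi', hj'⟩, h⟩, h1, h2⟩
  · rintro ⟨i, j, i', j', ⟨⟨⟨hi, hj⟩, hi', hj'⟩, h⟩, h1, h2⟩
    exact ⟨i, hi, j, hj, i', hi', j', hj', h, h1, h2⟩

lemma measurableSet_badBox {m : MeasurableSpace Ω} {bad : ℤ × ℤ → Set Ω}
    (h : ∀ u, MeasurableSet (bad u)) (n : ℕ) (b : ℤ × ℤ) :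
    MeasurableSet {ω | BadBox L (fun u => ω ∈ bad u) n b} := by
  induction n generalizing b with
  | zero => exact h b
  | succ n ih =>
    rw [setOf_badBox_succ]
    exact Finset.measurableSet_biUnion _ fun c _ => (ih _).inter (ih _)

/-- The coordinates on which the state of a box of level `n` depends. -/
def boxSupport (L : ℕ) (S : ℤ × ℤ → Set ι) : ℕ → ℤ × ℤ → Set ι
  | 0, b => S b
  | n + 1, b => ⋃ (i : ℕ) (_ : i < 2 * L + 1) (j : ℕ) (_ : j < 2 * L + 1),
      boxSupport L S n (cell L b i j)

/-- Separation by `L` passes down the levels: boxes `L` apart have corners `(2L+1)L ≥ 3L` cells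
apart, an offset inside a box uses up at most `2L`, and `L` remains. -/
lemma disjoint_boxSupport (hL : 1 ≤ L) {S : ℤ × ℤ → Set ι}
    (hS : ∀ u v : ℤ × ℤ, u.1 + L ≤ v.1 ∨ u.2 + L ≤ v.2 → Disjoint (S u) (S v)) (n : ℕ)
    (u v : ℤ × ℤ) (h : u.1 + L ≤ v.1 ∨ u.2 + L ≤ v.2) :
    Disjoint (boxSupport L S n u) (boxSupport L S n v) := by
  induction n generalizing u v with
  | zero => exact hS u v h
  | succ n ih =>
    simp only [boxSupport, Set.disjoint_iUnion_left, Set.disjoint_iUnion_right]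
    intro i' hi' j' hj' i hi j hj
    refine ih _ _ (h.imp ?_ ?_) <;>
    · intro h
      simp only [cell]
      have := mul_le_mul_of_nonneg_left h (show (0 : ℤ) ≤ 2 * L + 1 by positivity)
      have h3 : (2 * L + 1 : ℤ) * L ≥ 3 * L := by nlinarith
      rw [mul_add] at this
      omega

variable {mΩ : MeasurableSpace Ω} {P : Measure Ω} {m : ι → MeasurableSpace Ω}

lemma measurableSet_badBox_boxSupport {S : ℤ × ℤ → Set ι} {bad : ℤ × ℤ → Set Ω}
    (hbad : ∀ u, MeasurableSet[⨆ i ∈ S u, m i] (bad u)) (n : ℕ) (b : ℤ × ℤ) :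
    MeasurableSet[⨆ i ∈ boxSupport L S n b, m i]
      {ω | BadBox L (fun u => ω ∈ bad u) n b} := by
  induction n generalizing b with
  | zero => exact hbad b
  | succ n ih =>
    have hsub : ∀ i < 2 * L + 1, ∀ j < 2 * L + 1,
        (⨆ k ∈ boxSupport L S n (cell L b i j), m k) ≤
          ⨆ k ∈ boxSupport L S (n + 1) b, m k := by
      intro i hi j hj
      refine biSup_mono fun k hk => ?_
      simp only [boxSupport, Set.mem_iUnion]
      exact ⟨i, hi, j, hj, hk⟩
    rw [setOf_badBox_succ]
    refine Finset.measurableSet_biUnion _ fun c hc => ?_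
    simp only [Finset.mem_filter, Finset.mem_product, Finset.mem_range] at hc
    exact (hsub _ hc.1.1.1 _ hc.1.1.2 _ (ih _)).inter (hsub _ hc.1.2.1 _ hc.1.2.2 _ (ih _))

/-- With `C = (2L+1)^4` bounding the number of pairs of cells, independence of distant cells gives
`p (n+1) ≤ C * p n ^ 2`, that is, `C * p (n+1) ≤ (C * p n) ^ 2`. Starting from at most `1/2`, this
quantity decays at least geometrically, which is all that is kept. -/
lemma measure_badBox_le [IsProbabilityMeasure P] (hL : 1 ≤ L) (hm : ∀ i, m i ≤ mΩ)
    (hind : iIndep m P)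
    {S : ℤ × ℤ → Set ι} (hS : ∀ u v : ℤ × ℤ, u.1 + L ≤ v.1 ∨ u.2 + L ≤ v.2 →
      Disjoint (S u) (S v)) {bad : ℤ × ℤ → Set Ω}
    (hbad : ∀ u, MeasurableSet[⨆ i ∈ S u, m i] (bad u)) {q : ℝ≥0∞}
    (hq : ∀ u, P (bad u) ≤ q) (hq' : (2 * L + 1 : ℝ≥0∞) ^ 4 * q ≤ 2⁻¹) (n : ℕ) (b : ℤ × ℤ) :
    (2 * L + 1 : ℝ≥0∞) ^ 4 * P {ω | BadBox L (fun u => ω ∈ bad u) n b} ≤ 2⁻¹ ^ (n + 1) := by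
  induction n generalizing b with
  | zero =>
    simp only [BadBox, Set.ofPred_mem_eq, zero_add, pow_one]
    exact le_trans (by gcongr; exact hq b) hq'
  | succ n ih =>
    set C : ℝ≥0∞ := (2 * L + 1 : ℝ≥0∞) ^ 4 with hC
    have hC0 : C ≠ 0 := by positivity
    have hCt : C ≠ ⊤ := by
      have : C = ((2 * L + 1) ^ 4 : ℕ) := by push_cast; rfl
      rw [this]; exact ENNReal.natCast_ne_top _
    set x : ℝ≥0∞ := C⁻¹ * 2⁻¹ ^ (n + 1) with hx
    have ih' : ∀ c, P {ω | BadBox L (fun u => ω ∈ bad u) n c} ≤ x := by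
      intro c
      rw [hx, ← ENNReal.mul_le_iff_le_inv hC0 hCt]
      exact ih c
    have hpair : ∀ c ∈ {c ∈ (Finset.range (2 * L + 1) ×ˢ Finset.range (2 * L + 1)) ×ˢ
          (Finset.range (2 * L + 1) ×ˢ Finset.range (2 * L + 1)) |
          c.1.1 + L ≤ c.2.1 ∨ c.1.2 + L ≤ c.2.2},
        P ({ω | BadBox L (fun u => ω ∈ bad u) n (cell L b c.1.1 c.1.2)} ∩
        {ω | BadBox L (fun u => ω ∈ bad u) n (cell L b c.2.1 c.2.2)}) ≤ x * x := by
      intro c hc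
      simp only [Finset.mem_filter, Finset.mem_product, Finset.mem_range] at hc
      have hdis : Disjoint (boxSupport L S n (cell L b c.1.1 c.1.2))
          (boxSupport L S n (cell L b c.2.1 c.2.2)) := by
        refine disjoint_boxSupport hL hS n _ _ (hc.2.imp ?_ ?_) <;>
        · intro h
          simp only [cell]
          omega
      have := indep_iSup_of_disjoint hm hind hdis
      rw [Indep_iff] at this
      rw [this _ _ (measurableSet_badBox_boxSupport hbad n _)
        (measurableSet_badBox_boxSupport hbad n _)]
      exact mul_le_mul' (ih' _) (ih' _)
    rw [setOf_badBox_succ]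
    calc C * P _ ≤ C * ∑ c ∈ {c ∈ (Finset.range (2 * L + 1) ×ˢ Finset.range (2 * L + 1)) ×ˢ
          (Finset.range (2 * L + 1) ×ˢ Finset.range (2 * L + 1)) |
          c.1.1 + L ≤ c.2.1 ∨ c.1.2 + L ≤ c.2.2}, x * x := by
          gcongr
          exact (measure_biUnion_finset_le _ _).trans (Finset.sum_le_sum hpair)
      _ ≤ C * (C * (x * x)) := by
          gcongr
          rw [Finset.sum_const, nsmul_eq_mul]
          gcongr
          calc _ ≤ ((((Finset.range (2 * L + 1) ×ˢ Finset.range (2 * L + 1)) ×ˢ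
              (Finset.range (2 * L + 1) ×ˢ Finset.range (2 * L + 1))).card : ℕ) : ℝ≥0∞) := by
                exact_mod_cast Finset.card_filter_le _ _
            _ = C := by
              simp only [Finset.card_product, Finset.card_range, hC]; push_cast; ring
      _ = (C * x) * (C * x) := by ring
      _ = 2⁻¹ ^ (n + 1) * 2⁻¹ ^ (n + 1) := by
          have hCx : C * x = 2⁻¹ ^ (n + 1) := by
            rw [hx, ← mul_assoc, ENNReal.mul_inv_cancel hC0 hCt, one_mul]
          rw [hCx]
      _ = 2⁻¹ ^ (n + 1 + 1) * 2⁻¹ ^ n := by ring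
      _ ≤ 2⁻¹ ^ (n + 1 + 1) := mul_le_of_le_one_right' (pow_le_one' (by simp) n)

/-- A field with dependence range `L` whose sites are bad with small enough probability has,
with positive probability, only good boxes in the first rows at the origin. -/
lemma measure_forall_not_badBox_pos [IsProbabilityMeasure P] (hL : 1 ≤ L) (hm : ∀ i, m i ≤ mΩ)
    (hind : iIndep m P)
    {S : ℤ × ℤ → Set ι} (hS : ∀ u v : ℤ × ℤ, u.1 + L ≤ v.1 ∨ u.2 + L ≤ v.2 →
      Disjoint (S u) (S v)) {bad : ℤ × ℤ → Set Ω}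
    (hbad : ∀ u, MeasurableSet[⨆ i ∈ S u, m i] (bad u)) {q : ℝ≥0∞}
    (hq : ∀ u, P (bad u) ≤ q) (hq' : (2 * L + 1 : ℝ≥0∞) ^ 4 * q ≤ 2⁻¹) :
    0 < P {ω | ∀ n, ∀ i < 2 * L + 1, ¬ BadBox L (fun u => ω ∈ bad u) n ((i : ℕ), 0)} := by
  set C : ℝ≥0∞ := (2 * L + 1 : ℝ≥0∞) with hC
  have hC0 : C ≠ 0 := by positivity
  have hCt : C ≠ ⊤ := by
    have : C = ((2 * L + 1) : ℕ) := by push_cast; rfl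
    rw [this]; exact ENNReal.natCast_ne_top _
  have hC3 : (2 : ℝ≥0∞) ≤ C := by
    have : ((2 : ℕ) : ℝ≥0∞) ≤ ((2 * L + 1 : ℕ) : ℝ≥0∞) := by exact_mod_cast (by omega)
    simpa [hC] using this
  set G := {ω | ∀ n, ∀ i < 2 * L + 1, ¬ BadBox L (fun u => ω ∈ bad u) n ((i : ℕ), 0)} with hG
  have hcompl : Gᶜ ⊆ ⋃ n, ⋃ i ∈ Finset.range (2 * L + 1),
      {ω | BadBox L (fun u => ω ∈ bad u) n ((i : ℕ), 0)} := by
    intro ω hω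
    simp only [hG, Set.mem_compl_iff, Set.mem_ofPred_eq] at hω
    push Not at hω
    obtain ⟨n, i, hi, h⟩ := hω
    simp only [Set.mem_iUnion, Finset.mem_range]
    exact ⟨n, i, hi, h⟩
  -- At level `n` there are `C = 2L+1` boxes, each bad with probability at most `2⁻¹ ^ (n+1) / C^4`;
  -- summing over `n` leaves `C⁻³`.
  have h1 : P Gᶜ ≤ (C ^ 3)⁻¹ := by
    calc P Gᶜ ≤ ∑' n, ∑ i ∈ Finset.range (2 * L + 1),
          P {ω | BadBox L (fun u => ω ∈ bad u) n ((i : ℕ), 0)} :=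
          (measure_mono hcompl).trans ((measure_iUnion_le _).trans
            (ENNReal.tsum_le_tsum fun n => measure_biUnion_finset_le _ _))
      _ ≤ ∑' n : ℕ, (C ^ 3)⁻¹ * 2⁻¹ ^ (n + 1) := by
          refine ENNReal.tsum_le_tsum fun n => ?_
          calc _ ≤ ∑ i ∈ Finset.range (2 * L + 1), (C ^ 4)⁻¹ * 2⁻¹ ^ (n + 1) := by
                refine Finset.sum_le_sum fun i _ => ?_
                rw [← ENNReal.mul_le_iff_le_inv (by positivity) (by finiteness)]
                exact measure_badBox_le hL hm hind hS hbad hq hq' n _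
            _ = C * (C ^ 4)⁻¹ * 2⁻¹ ^ (n + 1) := by
                rw [Finset.sum_const, nsmul_eq_mul, Finset.card_range, mul_assoc]
                push_cast; rfl
            _ = _ := by
                congr 1
                rw [pow_succ' C 3, ENNReal.mul_inv (Or.inl hC0) (Or.inl hCt), ← mul_assoc,
                  ENNReal.mul_inv_cancel hC0 hCt, one_mul]
      _ = (C ^ 3)⁻¹ := by
          rw [ENNReal.tsum_mul_left, ENNReal.tsum_geometric_add_one]
          simp [ENNReal.inv_mul_cancel]
  have h2 : P Gᶜ < 1 := by
    refine h1.trans_lt ?_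
    rw [ENNReal.inv_lt_one]
    calc (1 : ℝ≥0∞) < 2 := by norm_num
      _ ≤ C := hC3
      _ ≤ C ^ 3 := le_self_pow₀ (le_trans (by norm_num) hC3) (by norm_num)
  by_contra h0
  have h0 : P G = 0 := by simpa using h0
  have h3 : (1 : ℝ≥0∞) ≤ P G + P Gᶜ := by
    rw [← measure_univ (μ := P), ← Set.union_compl_self G]
    exact measure_union_le _ _
  rw [h0, zero_add] at h3
  exact absurd h2 (not_lt.mpr h3)

end HierarchyProbability

/-! ### Independence of the coordinates of a sample -/

section Independence

/-- A finite intersection of events that each depend on one factor is a rectangle, so its measure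
splits into the two factors, where the given independence applies. -/
lemma iIndep_sumElim_prod {Ω Ω' ι κ : Type*} {mΩ : MeasurableSpace Ω} {mΩ' : MeasurableSpace Ω'}
    {μ : Measure Ω} {ν : Measure Ω'} [IsProbabilityMeasure μ] [IsProbabilityMeasure ν]
    {m : ι → MeasurableSpace Ω} {m' : κ → MeasurableSpace Ω'}
    (h : iIndep m μ) (h' : iIndep m' ν) :
    iIndep (Sum.elim (fun i => (m i).comap Prod.fst) fun i => (m' i).comap Prod.snd)
      (μ.prod ν) := by
  classical
  rw [iIndep_iff] at h h' ⊢
  intro s f hf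
  have h1 : ∀ i, ∃ A, i ∈ s.toLeft → MeasurableSet[m i] A ∧ Prod.fst ⁻¹' A = f (Sum.inl i) := by
    intro i
    by_cases hi : i ∈ s.toLeft
    · obtain ⟨A, hA⟩ := hf (Sum.inl i) (by simpa using hi)
      exact ⟨A, fun _ => hA⟩
    · exact ⟨∅, fun h => absurd h hi⟩
  have h2 : ∀ i, ∃ A, i ∈ s.toRight → MeasurableSet[m' i] A ∧ Prod.snd ⁻¹' A = f (Sum.inr i) := by
    intro i
    by_cases hi : i ∈ s.toRight
    · obtain ⟨A, hA⟩ := hf (Sum.inr i) (by simpa using hi)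
      exact ⟨A, fun _ => hA⟩
    · exact ⟨∅, fun h => absurd h hi⟩
  choose A hA using h1
  choose B hB using h2
  have hset : ⋂ i ∈ s, f i = (⋂ i ∈ s.toLeft, A i) ×ˢ (⋂ i ∈ s.toRight, B i) := by
    ext ⟨x, y⟩
    simp only [Set.mem_iInter, Set.mem_prod]
    constructor
    · intro hx
      refine ⟨fun i hi => ?_, fun i hi => ?_⟩
      · have := hx (Sum.inl i) (by simpa using hi)
        rwa [← (hA i hi).2] at this
      · have := hx (Sum.inr i) (by simpa using hi)
        rwa [← (hB i hi).2] at this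
    · rintro ⟨hx, hy⟩ (i | i) hi
      · have hi' : i ∈ s.toLeft := by simpa using hi
        rw [← (hA i hi').2]; exact hx i hi'
      · have hi' : i ∈ s.toRight := by simpa using hi
        rw [← (hB i hi').2]; exact hy i hi'
  rw [hset, Measure.prod_prod, h s.toLeft fun i hi => (hA i hi).1,
    h' s.toRight fun i hi => (hB i hi).1]
  conv_rhs => rw [← Finset.toLeft_disjSum_toRight (u := s), Finset.prod_disjSum]
  congr 1
  · refine Finset.prod_congr rfl fun i hi => ?_
    rw [← (hA i hi).2, ← Set.prod_univ, Measure.prod_prod, measure_univ, mul_one]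
  · refine Finset.prod_congr rfl fun i hi => ?_
    rw [← (hB i hi).2, ← Set.univ_prod, Measure.prod_prod, measure_univ, one_mul]

variable {d : ℕ} {M : Type*} [MeasurableSpace M]

/-- Names for the coordinates of a sample. -/
abbrev CoordIndex (d : ℕ) : Type := (Fin d → ℤ) ⊕ Label d ⊕ Sym2 (Option (Label d))

/-- The σ-algebra generated by a coordinate of the sample. -/
@[reducible]
def coordSigma (d : ℕ) (M : Type*) [MeasurableSpace M] :
    CoordIndex d → MeasurableSpace (Sample d M)
  | Sum.inl z => MeasurableSpace.comap (fun ω => ω.1 z) inferInstance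
  | Sum.inr (Sum.inl a) => MeasurableSpace.comap (fun ω => ω.2.1 a) inferInstance
  | Sum.inr (Sum.inr e) => MeasurableSpace.comap (fun ω => ω.2.2 e) inferInstance

/-- The σ-algebra generated by a set of coordinates of the sample. -/
@[reducible]
def sigmaOf (M : Type*) [MeasurableSpace M] (S : Set (CoordIndex d)) :
    MeasurableSpace (Sample d M) :=
  ⨆ i ∈ S, coordSigma d M i

lemma coordSigma_le (i : CoordIndex d) :
    coordSigma d M i ≤ (inferInstance : MeasurableSpace (Sample d M)) := by
  rcases i with z | a | e <;> simp only [coordSigma] <;>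
    rw [← measurable_iff_comap_le] <;> fun_prop

lemma sigmaOf_le (S : Set (CoordIndex d)) :
    sigmaOf M S ≤ (inferInstance : MeasurableSpace (Sample d M)) :=
  iSup₂_le fun i _ => coordSigma_le i

lemma sigmaOf_mono {S T : Set (CoordIndex d)} (h : S ⊆ T) : sigmaOf M S ≤ sigmaOf M T :=
  biSup_mono h

lemma measurable_count {S : Set (CoordIndex d)} {z : Fin d → ℤ} (h : Sum.inl z ∈ S) :
    Measurable[sigmaOf M S] fun ω : Sample d M => ω.1 z :=
  measurable_iff_comap_le.mpr
    (le_iSup₂ (f := fun i (_ : i ∈ S) => coordSigma d M i) (Sum.inl z) h)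

lemma measurable_label {S : Set (CoordIndex d)} {a : Label d} (h : Sum.inr (Sum.inl a) ∈ S) :
    Measurable[sigmaOf M S] fun ω : Sample d M => ω.2.1 a :=
  measurable_iff_comap_le.mpr
    (le_iSup₂ (f := fun i (_ : i ∈ S) => coordSigma d M i) (Sum.inr (Sum.inl a)) h)

lemma measurable_edge {S : Set (CoordIndex d)} {e : Sym2 (Option (Label d))}
    (h : Sum.inr (Sum.inr e) ∈ S) :
    Measurable[sigmaOf M S] fun ω : Sample d M => ω.2.2 e :=
  measurable_iff_comap_le.mpr
    (le_iSup₂ (f := fun i (_ : i ∈ S) => coordSigma d M i) (Sum.inr (Sum.inr e)) h)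

variable (Q : Measure M) [IsProbabilityMeasure Q] (t : ℝ≥0)

instance : IsProbabilityMeasure (law d Q t) := by unfold law; infer_instance

lemma iIndep_coordSigma : iIndep (coordSigma d M) (law d Q t) := by
  have h1 := (iIndepFun_infinitePi (P := fun _ : Fin d → ℤ => poissonMeasure t)
    (X := fun _ n => n) fun _ => measurable_id).iIndep
  have h2 := (iIndepFun_infinitePi
    (P := fun _ : Label d => (volume : Measure (Fin d → unitInterval)).prod Q)
    (X := fun _ n => n) fun _ => measurable_id).iIndep
  have h3 := (iIndepFun_infinitePi
    (P := fun _ : Sym2 (Option (Label d)) => (volume : Measure unitInterval))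
    (X := fun _ n => n) fun _ => measurable_id).iIndep
  have h := iIndep_sumElim_prod h1 (iIndep_sumElim_prod h2 h3)
  unfold law
  convert h using 1
  funext i
  rcases i with z | a | e <;> simp [coordSigma, MeasurableSpace.comap_comp, Function.comp_def]

lemma indep_sigmaOf {S T : Set (CoordIndex d)} (h : Disjoint S T) :
    Indep (sigmaOf M S) (sigmaOf M T) (law d Q t) :=
  indep_iSup_of_disjoint coordSigma_le (iIndep_coordSigma Q t) h

lemma map_count (z : Fin d → ℤ) :
    (law d Q t).map (fun ω => ω.1 z) = poissonMeasure t := by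
  have : (fun ω : Sample d M => ω.1 z) = (fun f => f z) ∘ Prod.fst := rfl
  rw [this, ← Measure.map_map (by fun_prop) (by fun_prop), law, Measure.map_fst_prod,
    measure_univ, one_smul, Measure.infinitePi_map_eval]

lemma map_label (a : Label d) :
    (law d Q t).map (fun ω => ω.2.1 a) = (volume : Measure (Fin d → unitInterval)).prod Q := by
  have : (fun ω : Sample d M => ω.2.1 a) = (fun f => f a) ∘ Prod.fst ∘ Prod.snd := rfl
  rw [this, ← Measure.map_map (by fun_prop) (by fun_prop),
    ← Measure.map_map (by fun_prop) (by fun_prop), law, Measure.map_snd_prod,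
    measure_univ, one_smul, Measure.map_fst_prod,
    measure_univ, one_smul, Measure.infinitePi_map_eval]

lemma map_edge (e : Sym2 (Option (Label d))) :
    (law d Q t).map (fun ω => ω.2.2 e) = (volume : Measure unitInterval) := by
  have : (fun ω : Sample d M => ω.2.2 e) = (fun f => f e) ∘ Prod.snd ∘ Prod.snd := rfl
  rw [this, ← Measure.map_map (by fun_prop) (by fun_prop),
    ← Measure.map_map (by fun_prop) (by fun_prop), law, Measure.map_snd_prod,
    measure_univ, one_smul, Measure.map_snd_prod,
    measure_univ, one_smul, Measure.infinitePi_map_eval]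

end Independence

/-! ### Uniform two-step connections via compactness-free `L²` arguments -/

section TwoStep

open Filter Topology

variable {d : ℕ} {M : Type*} [MeasurableSpace M]

/-- The shift of the location. -/
def shift (x : EuclideanSpace ℝ (Fin d)) (w : Space d M) : Space d M := (w.1 + x, w.2)

lemma measurePreserving_shift (Q : Measure M) [IsProbabilityMeasure Q]
    (x : EuclideanSpace ℝ (Fin d)) :
    MeasurePreserving (shift x) (volume.prod Q) (volume.prod Q) :=
  (measurePreserving_add_right volume x).prod (MeasurePreserving.id Q)

lemma ConnectionFunction.shift_shift (φ : ConnectionFunction d M) (x : EuclideanSpace ℝ (Fin d))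
    (v w : Space d M) : φ.toFun (shift x v) (shift x w) = φ.toFun v w := by
  obtain ⟨v, p⟩ := v
  obtain ⟨w, q⟩ := w
  simp only [shift]
  rw [φ.translation, φ.translation v]
  simp

/-- The connection function seen from a mark at the origin, cut off outside of a ball. -/
noncomputable def cutoff (φ : ConnectionFunction d M) (R : ℝ) (p : M) : Space d M → ℝ :=
  {w : Space d M | ‖w.1‖ ≤ R}.indicator fun w => φ.toFun (0, p) w

lemma measurable_uncurry_cutoff (φ : ConnectionFunction d M) (R : ℝ) :
    Measurable fun z : M × Space d M => cutoff φ R z.1 z.2 := by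
  have h : Measurable fun z : M × Space d M => φ.toFun (0, z.1) z.2 :=
    φ.measurable.comp (by fun_prop : Measurable fun z : M × Space d M => (((0, z.1), z.2) :
      Space d M × Space d M))
  have hs : MeasurableSet {z : M × Space d M | ‖z.2.1‖ ≤ R} :=
    measurableSet_le (by fun_prop) measurable_const
  exact h.indicator hs

lemma cutoff_nonneg (φ : ConnectionFunction d M) (R : ℝ) (p : M) (w : Space d M) :
    0 ≤ cutoff φ R p w :=
  Set.indicator_nonneg (fun _ _ => φ.nonneg _ _) _

lemma cutoff_le (φ : ConnectionFunction d M) (R : ℝ) (p : M) (w : Space d M) :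
    cutoff φ R p w ≤ φ.toFun (0, p) w :=
  Set.indicator_le_self' (fun _ _ => φ.nonneg _ _) _

lemma memLp_cutoff (φ : ConnectionFunction d M) (Q : Measure M) [IsProbabilityMeasure Q]
    (R : ℝ) (p : M) : MemLp (cutoff φ R p) 2 (volume.prod Q) := by
  have hs : MeasurableSet {w : Space d M | ‖w.1‖ ≤ R} :=
    measurableSet_le (by fun_prop) measurable_const
  have hfin : (volume.prod Q) {w : Space d M | ‖w.1‖ ≤ R} < ⊤ := by
    have : {w : Space d M | ‖w.1‖ ≤ R} = Metric.closedBall 0 R ×ˢ Set.univ := by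
      ext w; simp
    rw [this, Measure.prod_prod, measure_univ, mul_one]
    exact measure_closedBall_lt_top
  unfold cutoff
  rw [memLp_indicator_iff_restrict hs]
  have : IsFiniteMeasure ((volume.prod Q).restrict {w : Space d M | ‖w.1‖ ≤ R}) :=
    ⟨by simpa using hfin⟩
  refine MemLp.of_bound (φ.measurable.comp (by fun_prop : Measurable fun w : Space d M =>
    (((0, p), w) : Space d M × Space d M))).aestronglyMeasurable 1 (ae_of_all _ fun w => ?_)
  change ‖φ.toFun (0, p) w‖ ≤ 1
  rw [Real.norm_of_nonneg (φ.nonneg _ _)]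
  exact φ.le_one _ _

lemma measurable_eLpNorm_two {X Y : Type*} [MeasurableSpace X] [MeasurableSpace Y]
    {μ : Measure Y} [SFinite μ] {F : X → Y → ℝ} (hF : Measurable (Function.uncurry F)) :
    Measurable fun x => eLpNorm (F x) 2 μ := by
  simp_rw [eLpNorm_eq_lintegral_rpow_enorm_toReal (p := 2) (by norm_num) (by norm_num)]
  refine Measurable.pow_const ?_ _
  exact Measurable.lintegral_prod_right' (f := fun z : X × Y => ‖F z.1 z.2‖ₑ ^ (2 : ℝ≥0∞).toReal)
    (hF.enorm.pow_const _)

/-- Otherwise, running through countably many radii and thresholds, almost every mark has all its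
cutoffs of norm zero, and Fubini makes `φ` vanish almost everywhere. -/
lemma exists_cutoff_ne_zero (φ : ConnectionFunction d M) (Q : Measure M) [IsProbabilityMeasure Q]
    (h : ¬ ∀ᵐ w : EuclideanSpace ℝ (Fin d) × M × M ∂(volume.prod (Q.prod Q)),
      φ.toFun (0, w.2.1) (w.1, w.2.2) = 0) :
    ∃ (R : ℝ) (κ : ℝ), 0 < R ∧ 0 < κ ∧
      Q {p | ENNReal.ofReal (10 * κ) < eLpNorm (cutoff φ R p) 2 (volume.prod Q)} ≠ 0 := by
  by_contra! hcon
  apply h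
  have h1 : ∀ᵐ p ∂Q, ∀ n k : ℕ,
      eLpNorm (cutoff φ (n + 1) p) 2 (volume.prod Q) ≤ ENNReal.ofReal (10 * (1 / (k + 1))) := by
    rw [ae_all_iff]; intro n
    rw [ae_all_iff]; intro k
    have := hcon (n + 1) (1 / (k + 1)) (by positivity) (by positivity)
    rw [ae_iff]
    simpa using this
  have h2 : ∀ᵐ p ∂Q, ∀ᵐ w : Space d M ∂(volume.prod Q), φ.toFun (0, p) w = 0 := by
    filter_upwards [h1] with p hp
    have h3 : ∀ n : ℕ, ∀ᵐ w : Space d M ∂(volume.prod Q), cutoff φ (n + 1) p w = 0 := by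
      intro n
      have h4 : eLpNorm (cutoff φ (n + 1) p) 2 (volume.prod Q) = 0 := by
        have hlim : Tendsto (fun k : ℕ => ENNReal.ofReal (10 * (1 / (k + 1)))) atTop (𝓝 0) := by
          have := (tendsto_one_div_add_atTop_nhds_zero_nat (𝕜 := ℝ)).const_mul 10
          simpa using ENNReal.tendsto_ofReal this
        exact le_antisymm (ge_of_tendsto' hlim (hp n)) bot_le
      rw [eLpNorm_eq_zero_iff (memLp_cutoff φ Q _ p).1 (by norm_num)] at h4
      exact h4
    filter_upwards [ae_all_iff.mpr h3] with w hw
    obtain ⟨n, hn⟩ := exists_nat_ge ‖w.1‖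
    have := hw n
    rwa [cutoff, Set.indicator_of_mem] at this
    show ‖w.1‖ ≤ n + 1
    linarith
  have hmeas : MeasurableSet {z : M × Space d M | φ.toFun (0, z.1) z.2 = 0} :=
    (φ.measurable.comp (by fun_prop : Measurable fun z : M × Space d M => (((0, z.1), z.2) :
      Space d M × Space d M))) (measurableSet_singleton 0)
  have h5 : ∀ᵐ z : M × Space d M ∂(Q.prod (volume.prod Q)), φ.toFun (0, z.1) z.2 = 0 :=
    (Measure.ae_prod_iff_ae_ae hmeas).mpr h2
  have h6 : MeasurePreserving (fun w : EuclideanSpace ℝ (Fin d) × M × M =>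
      ((w.2.1, (w.1, w.2.2)) : M × Space d M)) (volume.prod (Q.prod Q))
      (Q.prod (volume.prod Q)) := by
    have e1 := measurePreserving_prodAssoc (volume : Measure (EuclideanSpace ℝ (Fin d))) Q Q
    have e2 := (Measure.measurePreserving_swap (μ := (volume : Measure (EuclideanSpace ℝ (Fin d))))
      (ν := Q)).prod (MeasurePreserving.id Q)
    have e3 := measurePreserving_prodAssoc Q (volume : Measure (EuclideanSpace ℝ (Fin d))) Q
    exact e3.comp (e2.comp (e1.symm _))
  exact h6.quasiMeasurePreserving.ae h5

/-- Uniform lower bound for the number of two-step connections between close points with marks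
in a suitable set of positive measure. -/
theorem exists_two_step [MetricSpace M] [CompleteSpace M] [TopologicalSpace.SeparableSpace M]
    [BorelSpace M] (φ : ConnectionFunction d M) (Q : Measure M) [IsProbabilityMeasure Q]
    (h : ¬ ∀ᵐ w : EuclideanSpace ℝ (Fin d) × M × M ∂(volume.prod (Q.prod Q)),
      φ.toFun (0, w.2.1) (w.1, w.2.2) = 0) :
    ∃ (A : Set M) (ρ R c : ℝ), MeasurableSet A ∧ 0 < Q A ∧ 0 < ρ ∧ 0 < R ∧ 0 < c ∧
      ∀ v v' : Space d M, v.2 ∈ A → v'.2 ∈ A → ‖v'.1 - v.1‖ < ρ →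
        ENNReal.ofReal c ≤ ∫⁻ w in {w : Space d M | ‖w.1 - v.1‖ ≤ R},
          ENNReal.ofReal (φ.toFun v w) * ENNReal.ofReal (φ.toFun v' w) ∂(volume.prod Q) := by
  have : SecondCountableTopology M := UniformSpace.secondCountable_of_separable M
  obtain ⟨R, κ, hR, hκ, hS⟩ := exists_cutoff_ne_zero φ Q h
  set μ : Measure (Space d M) := volume.prod Q with hμ
  let f : M → Lp ℝ 2 μ := fun p => (memLp_cutoff φ Q R p).toLp
  set A' : Lp ℝ 2 μ → Set M := fun g =>
    {p | eLpNorm (fun w => cutoff φ R p w - g w) 2 μ < ENNReal.ofReal κ ∧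
      ENNReal.ofReal (10 * κ) < eLpNorm (cutoff φ R p) 2 μ} with hA'
  have hdist : ∀ p (g : Lp ℝ 2 μ), ENNReal.ofReal ‖f p - g‖ = eLpNorm (fun w => cutoff φ R p w - g w) 2 μ := by
    intro p g
    rw [Lp.norm_def, ENNReal.ofReal_toReal (Lp.eLpNorm_ne_top _)]
    refine eLpNorm_congr_ae ?_
    filter_upwards [Lp.coeFn_sub (f p) g, (memLp_cutoff φ Q R p).coeFn_toLp] with w h1 h2
    rw [h1, Pi.sub_apply, h2]
  have hnorm : ∀ p, ENNReal.ofReal ‖f p‖ = eLpNorm (cutoff φ R p) 2 μ := by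
    intro p
    rw [Lp.norm_def, ENNReal.ofReal_toReal (Lp.eLpNorm_ne_top _)]
    exact eLpNorm_congr_ae (memLp_cutoff φ Q R p).coeFn_toLp
  -- The sets `A' g` with `g` in a countable dense subset of `L²` cover all marks of large norm, so
  -- they cannot all be null.
  obtain ⟨g, hg⟩ : ∃ g, Q (A' g) ≠ 0 := by
    by_contra! hcon
    apply hS
    have : Fact ((2 : ℝ≥0∞) ≠ ⊤) := ⟨by norm_num⟩
    obtain ⟨D, hDc, hD⟩ := TopologicalSpace.exists_countable_dense (Lp ℝ 2 μ)
    have hsub : {p | ENNReal.ofReal (10 * κ) < eLpNorm (cutoff φ R p) 2 μ} ⊆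
        ⋃ g ∈ D, A' g := by
      intro p hp
      obtain ⟨g, hgD, hg⟩ := hD.exists_dist_lt (f p) hκ
      simp only [Set.mem_iUnion]
      refine ⟨g, hgD, ?_, hp⟩
      rw [← hdist, ENNReal.ofReal_lt_ofReal_iff hκ, ← dist_eq_norm]
      exact hg
    exact measure_mono_null hsub ((measure_biUnion_null_iff hDc).mpr fun g _ => hcon g)
  have hAmeas : MeasurableSet (A' g) := by
    refine MeasurableSet.inter (measurableSet_lt (measurable_eLpNorm_two
      (F := fun p w => cutoff φ R p w - g w) ?_) measurable_const)
      (measurableSet_lt measurable_const (measurable_eLpNorm_two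
        (F := fun p => cutoff φ R p) (measurable_uncurry_cutoff φ R)))
    exact (measurable_uncurry_cutoff φ R).sub
      ((Lp.stronglyMeasurable g).measurable.comp measurable_snd)
  -- Translations are bundled as continuous maps so that continuity of composition in `Lp` applies;
  -- it supplies the radius `ρ`.
  let sh : EuclideanSpace ℝ (Fin d) → C(Space d M, Space d M) := fun x =>
    ⟨fun w => (w.1 + -x, w.2), by fun_prop⟩
  have hsh : ∀ x, MeasurePreserving (sh x) μ μ := fun x => measurePreserving_shift Q (-x)
  let T : EuclideanSpace ℝ (Fin d) → Lp ℝ 2 μ → Lp ℝ 2 μ := fun x g =>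
    Lp.compMeasurePreserving (sh x) (hsh x) g
  have hT0 : T 0 g = g := by
    refine Lp.ext ?_
    filter_upwards [Lp.coeFn_compMeasurePreserving g (hsh 0)] with w hw
    simp only [T]
    rw [hw]
    simp [sh]
  have hTcont : Tendsto (fun x => T x g) (𝓝 0) (𝓝 g) := by
    have hc : Continuous sh := by
      refine ContinuousMap.continuous_of_continuous_uncurry _ ?_
      simp only [sh, Function.uncurry_def, ContinuousMap.coe_mk]
      fun_prop
    have := (continuous_const (y := g)).compMeasurePreservingLp hc hsh (by norm_num)
    have h2 := this.tendsto 0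
    have h3 : Lp.compMeasurePreserving (sh 0) (hsh 0) g = g := hT0
    rw [h3] at h2
    exact h2
  obtain ⟨ρ, hρ, hρT⟩ := Metric.eventually_nhds_iff.mp
    (hTcont.eventually (Metric.ball_mem_nhds g hκ))
  refine ⟨A' g, ρ, R, κ ^ 2, hAmeas, pos_iff_ne_zero.mpr hg, hρ, hR, by positivity, ?_⟩
  have key : ∀ p ∈ A' g, ∀ p' ∈ A' g, ∀ x : EuclideanSpace ℝ (Fin d), ‖x‖ < ρ →
      ENNReal.ofReal (κ ^ 2) ≤ ∫⁻ w in {w : Space d M | ‖w.1‖ ≤ R},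
          ENNReal.ofReal (φ.toFun (0, p) w) * ENNReal.ofReal (φ.toFun (x, p') w) ∂μ := by
    intro p hp p' hp' x hx
    have hclose : ∀ p ∈ A' g, ‖f p - g‖ < κ := fun p hp => by
      have := hp.1
      rwa [← hdist, ENNReal.ofReal_lt_ofReal_iff hκ] at this
    have hlarge : ∀ p ∈ A' g, 10 * κ < ‖f p‖ := fun p hp => by
      have := hp.2
      rw [← hnorm] at this
      exact (ENNReal.ofReal_lt_ofReal_iff_of_nonneg (by positivity)).mp this
    have hTn : ‖T x (f p')‖ = ‖f p'‖ := Lp.norm_compMeasurePreserving _ _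
    have hTs : ‖T x (f p') - T x g‖ = ‖f p' - g‖ := by
      rw [← Lp.norm_compMeasurePreserving (f p' - g) (hsh x)]
      simp only [T, map_sub]
    have hxg : ‖T x g - g‖ < κ := by
      have := hρT (y := x) (by simpa using hx)
      rwa [dist_eq_norm] at this
    have h3 : ‖f p - T x (f p')‖ ≤ 3 * κ := by
      have e : f p - T x (f p') = (f p - g) - (T x g - g) - (T x (f p') - T x g) := by abel
      rw [e]
      have a1 := norm_sub_le ((f p - g) - (T x g - g)) (T x (f p') - T x g)
      have a2 := norm_sub_le (f p - g) (T x g - g)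
      have a3 := hclose p hp
      have a4 := hclose p' hp'
      linarith
    -- Polarisation: twice the inner product is at least `(100 + 100 - 9) * κ ^ 2`.
    have hin : κ ^ 2 ≤ inner ℝ (f p) (T x (f p')) := by
      have e := norm_sub_sq_real (f p) (T x (f p'))
      have a1 := hlarge p hp
      have a2 := hlarge p' hp'
      rw [← hTn] at a2
      have b1 : (10 * κ) ^ 2 ≤ ‖f p‖ ^ 2 := by gcongr
      have b2 : (10 * κ) ^ 2 ≤ ‖T x (f p')‖ ^ 2 := by gcongr
      have b3 : ‖f p - T x (f p')‖ ^ 2 ≤ (3 * κ) ^ 2 := by gcongr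
      nlinarith
    rw [L2.inner_def] at hin
    have hae : (fun w => inner ℝ (f p w) (T x (f p') w)) =ᵐ[μ]
        fun w => cutoff φ R p w * cutoff φ R p' (sh x w) := by
      filter_upwards [(memLp_cutoff φ Q R p).coeFn_toLp,
        Lp.coeFn_compMeasurePreserving (f p') (hsh x),
        (hsh x).quasiMeasurePreserving.ae (memLp_cutoff φ Q R p').coeFn_toLp] with w h1 h2 h3
      simp only [T, f] at h1 h2 h3 ⊢
      rw [h2, h1, Function.comp_apply, h3]
      simp [mul_comm]
    have hint := L2.integrable_inner (𝕜 := ℝ) (f p) (T x (f p'))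
    rw [integral_congr_ae hae] at hin
    have hint' := hint.congr hae
    calc ENNReal.ofReal (κ ^ 2) ≤ ENNReal.ofReal (∫ w, cutoff φ R p w * cutoff φ R p' (sh x w) ∂μ) :=
          ENNReal.ofReal_le_ofReal hin
      _ = ∫⁻ w, ENNReal.ofReal (cutoff φ R p w * cutoff φ R p' (sh x w)) ∂μ :=
          ofReal_integral_eq_lintegral_ofReal hint'
            (ae_of_all _ fun w => mul_nonneg (cutoff_nonneg _ _ _ _) (cutoff_nonneg _ _ _ _))
      _ ≤ ∫⁻ w, {w : Space d M | ‖w.1‖ ≤ R}.indicator (fun w => ENNReal.ofReal (φ.toFun (0, p) w) *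
            ENNReal.ofReal (φ.toFun (x, p') w)) w ∂μ := by
          refine lintegral_mono fun w => ?_
          by_cases hw : ‖w.1‖ ≤ R
          · rw [Set.indicator_of_mem (by exact hw), ← ENNReal.ofReal_mul (φ.nonneg _ _)]
            refine ENNReal.ofReal_le_ofReal (mul_le_mul (cutoff_le _ _ _ _) ?_
              (cutoff_nonneg _ _ _ _) (φ.nonneg _ _))
            refine (cutoff_le _ _ _ _).trans_eq ?_
            rw [φ.translation x w.1]
            simp [sh, sub_eq_add_neg]
          · rw [cutoff, Set.indicator_of_notMem (by exact hw)]
            simp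
      _ = _ := lintegral_indicator (measurableSet_le (by fun_prop) measurable_const) _
  intro v v' hv hv' hvv
  have hk := key v.2 hv v'.2 hv' (v'.1 - v.1) hvv
  rw [← lintegral_indicator (measurableSet_le (by fun_prop) measurable_const)] at hk ⊢
  refine hk.trans_eq ?_
  -- What remains is to move the location of `v` to the origin by translation invariance of `φ` and
  -- of the measure.
  have hG : Measurable (({w : Space d M | ‖w.1 - v.1‖ ≤ R}).indicator fun w =>
      ENNReal.ofReal (φ.toFun v w) * ENNReal.ofReal (φ.toFun v' w)) := by
    refine Measurable.indicator ?_ (measurableSet_le (by fun_prop) measurable_const)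
    have h1 : ∀ u : Space d M, Measurable fun w => φ.toFun u w := fun u =>
      φ.measurable.comp (by fun_prop : Measurable fun w : Space d M => (u, w))
    exact (h1 v).ennreal_ofReal.mul (h1 v').ennreal_ofReal
  rw [← (measurePreserving_shift Q v.1).lintegral_comp hG]
  refine lintegral_congr fun w => ?_
  have e1 : shift v.1 ((0, v.2) : Space d M) = v := by simp [shift]
  have e2 : shift v.1 ((v'.1 - v.1, v'.2) : Space d M) = v' := by simp [shift]
  by_cases hw : ‖w.1‖ ≤ R
  · rw [Set.indicator_of_mem (by exact hw), Set.indicator_of_mem (by simpa [shift] using hw)]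
    rw [← φ.shift_shift v.1 (0, v.2) w, ← φ.shift_shift v.1 (v'.1 - v.1, v'.2) w, e1, e2]
  · rw [Set.indicator_of_notMem (by exact hw), Set.indicator_of_notMem (by simpa [shift] using hw)]

end TwoStep

/-! ### Cells, unit cubes and windows -/

section Geometry

set_option linter.unusedSectionVars false

variable {d : ℕ} {M : Type*} [MeasurableSpace M]

/-- The point with relative position and mark `x` in the unit cube `z`. -/
noncomputable def loc (z : Fin d → ℤ) (x : (Fin d → unitInterval) × M) : Space d M :=
  (WithLp.toLp 2 fun i => (z i : ℝ) + (x.1 i : ℝ), x.2)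

@[fun_prop]
lemma measurable_loc (z : Fin d → ℤ) :
    Measurable (loc z : (Fin d → unitInterval) × M → Space d M) := by
  refine Measurable.prodMk ?_ measurable_snd
  refine (WithLp.measurable_toLp 2 _).comp (measurable_pi_lambda _ fun i => ?_)
  exact measurable_const.add (measurable_subtype_coe.comp
    ((measurable_pi_apply i).comp measurable_fst))

/-- The part of the state space over the unit cube `z`. -/
def cube (M : Type*) (z : Fin d → ℤ) : Set (Space d M) :=
  {w | ∀ i, (z i : ℝ) ≤ w.1 i ∧ w.1 i ≤ z i + 1}

lemma measurePreserving_loc (Q : Measure M) [IsProbabilityMeasure Q] (z : Fin d → ℤ) :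
    MeasurePreserving (loc z) ((volume : Measure (Fin d → unitInterval)).prod Q)
      ((volume.prod Q).restrict (cube M z)) := by
  have h1 : ∀ i, MeasurePreserving (fun s : unitInterval => (z i : ℝ) + s) volume
      (volume.restrict (Set.Icc (z i : ℝ) (z i + 1))) := by
    intro i
    have := (measurePreserving_add_left (volume : Measure ℝ) (z i : ℝ)).restrict_preimage
      (measurableSet_Icc (a := (z i : ℝ)) (b := z i + 1))
    rw [show (fun x => (z i : ℝ) + x) ⁻¹' Set.Icc (z i : ℝ) (z i + 1) = unitInterval by
      ext x; simp [unitInterval]] at this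
    exact this.comp unitInterval.measurePreserving_coe
  have h2 := measurePreserving_pi (fun _ : Fin d => (volume : Measure unitInterval)) _ h1
  rw [← Measure.restrict_pi_pi] at h2
  have hm : MeasurableSet {y : EuclideanSpace ℝ (Fin d) | ∀ i, (z i : ℝ) ≤ y i ∧ y i ≤ z i + 1} := by
    have hi : ∀ i, Measurable fun y : EuclideanSpace ℝ (Fin d) => y i := fun i => by fun_prop
    rw [Set.ofPred_forall]
    exact MeasurableSet.iInter fun i => (measurableSet_le (measurable_const (a := (z i : ℝ)))
      (hi i)).inter (measurableSet_le (hi i) (measurable_const (a := (z i + 1 : ℝ))))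
  have h3 := (PiLp.volume_preserving_toLp (Fin d)).restrict_preimage hm
  have e : WithLp.toLp 2 ⁻¹' {y : EuclideanSpace ℝ (Fin d) | ∀ i, (z i : ℝ) ≤ y i ∧ y i ≤ z i + 1}
      = Set.pi Set.univ fun i => Set.Icc (z i : ℝ) (z i + 1) := by
    ext y; simp only [Set.mem_preimage, Set.mem_ofPred_eq, Set.mem_pi, Set.mem_univ, Set.mem_Icc,
      forall_true_left]
  rw [e] at h3
  have h4 := (h3.comp h2).prod (MeasurePreserving.id Q)
  have e2 : cube M z = {y : EuclideanSpace ℝ (Fin d) | ∀ i, (z i : ℝ) ≤ y i ∧ y i ≤ z i + 1}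
      ×ˢ (Set.univ : Set M) := by
    ext w; simp [cube]
  rw [e2, ← Measure.prod_restrict, Measure.restrict_univ]
  exact h4

/-- The site `u` of the planar lattice as an element of `ℤ^d`. -/
def fineIndex (d : ℕ) (u : ℤ × ℤ) : Fin d → ℤ := fun i =>
  if i.val = 0 then u.1 else if i.val = 1 then u.2 else 0

/-- The unit cube which contains the cell `u` of side length `1 / K`. -/
def unitIndex (d K : ℕ) (u : ℤ × ℤ) : Fin d → ℤ := fun i => fineIndex d u i / K

/-- The points with mark in `A` over the cell `u` of side length `1 / K`. -/
def region (d K : ℕ) (A : Set M) (u : ℤ × ℤ) : Set (Space d M) :=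
  {v | (∀ i, (fineIndex d u i : ℝ) ≤ K * v.1 i ∧ K * v.1 i < fineIndex d u i + 1) ∧ v.2 ∈ A}

lemma measurableSet_region {K : ℕ} {A : Set M} (hA : MeasurableSet A) (u : ℤ × ℤ) :
    MeasurableSet (region d K A u) := by
  have hi : ∀ i, Measurable fun v : Space d M => K * v.1 i := fun i => by fun_prop
  have h : region d K A u = (⋂ i, {v : Space d M | (fineIndex d u i : ℝ) ≤ K * v.1 i} ∩
      {v : Space d M | K * v.1 i < fineIndex d u i + 1}) ∩ Prod.snd ⁻¹' A := by
    ext v; simp [region]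
  rw [h]
  exact (MeasurableSet.iInter fun i => (measurableSet_le measurable_const (hi i)).inter
    (measurableSet_lt (hi i) measurable_const)).inter (measurable_snd hA)

lemma eq_of_mem_region (hd : 2 ≤ d) {K : ℕ} {A : Set M} {u u' : ℤ × ℤ} {v : Space d M}
    (h : v ∈ region d K A u) (h' : v ∈ region d K A u') : u = u' := by
  have key : ∀ i, fineIndex d u i = fineIndex d u' i := by
    intro i
    have h1 : (fineIndex d u i : ℝ) < fineIndex d u' i + 1 := (h.1 i).1.trans_lt (h'.1 i).2
    have h2 : (fineIndex d u' i : ℝ) < fineIndex d u i + 1 := (h'.1 i).1.trans_lt (h.1 i).2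
    norm_cast at h1 h2
    omega
  have k0 := key ⟨0, by omega⟩
  have k1 := key ⟨1, by omega⟩
  simp only [fineIndex] at k0 k1
  simp at k0 k1
  exact Prod.ext k0 k1

lemma unitIndex_le {K : ℕ} (hK : 0 < K) {A : Set M} {u : ℤ × ℤ} {v : Space d M}
    (h : v ∈ region d K A u) (i : Fin d) :
    (unitIndex d K u i : ℝ) ≤ v.1 i ∧ v.1 i < unitIndex d K u i + 1 := by
  have hK' : (0 : ℝ) < K := by exact_mod_cast hK
  have e1 : (K : ℤ) * unitIndex d K u i ≤ fineIndex d u i :=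
    Int.mul_ediv_self_le (by positivity)
  have e2 : fineIndex d u i + 1 ≤ K * (unitIndex d K u i + 1) := by
    have := Int.lt_mul_ediv_self_add (x := fineIndex d u i) (k := (K : ℤ)) (by positivity)
    simp only [unitIndex]
    rw [mul_add, mul_one]
    omega
  have e1' : (K : ℝ) * unitIndex d K u i ≤ fineIndex d u i := by exact_mod_cast e1
  have e2' : (fineIndex d u i + 1 : ℝ) ≤ K * (unitIndex d K u i + 1) := by exact_mod_cast e2
  have := h.1 i
  constructor
  · exact le_of_mul_le_mul_left (e1'.trans this.1) hK'
  · exact lt_of_mul_lt_mul_left (this.2.trans_le e2') hK'.le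

/-- The site `u'` is the right or the upper neighbour of `u`. -/
def Next (u u' : ℤ × ℤ) : Prop := u' = (u.1 + 1, u.2) ∨ u' = (u.1, u.2 + 1)

lemma norm_sub_lt_of_next {K : ℕ} (hK : 0 < K) {A : Set M} {u u' : ℤ × ℤ} (hu : Next u u')
    {v v' : Space d M} (h : v ∈ region d K A u) (h' : v' ∈ region d K A u') {ρ : ℝ}
    (hρ : (d + 1 : ℝ) * 2 < ρ * K) : ‖v'.1 - v.1‖ < ρ := by
  have hK' : (0 : ℝ) < K := by exact_mod_cast hK
  have hc : ∀ i, |v'.1 i - v.1 i| ≤ 2 / K := by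
    intro i
    have hf : fineIndex d u i ≤ fineIndex d u' i ∧ fineIndex d u' i ≤ fineIndex d u i + 1 := by
      rcases hu with rfl | rfl <;> simp only [fineIndex] <;> split_ifs <;> omega
    have hf1 : (fineIndex d u i : ℝ) ≤ fineIndex d u' i := by exact_mod_cast hf.1
    have hf2 : (fineIndex d u' i : ℝ) ≤ fineIndex d u i + 1 := by exact_mod_cast hf.2
    have a1 := h.1 i
    have a2 := h'.1 i
    rw [abs_le, le_div_iff₀ hK', ← neg_div, div_le_iff₀ hK']
    constructor <;> linarith
  -- The factor `d + 1` is a crude replacement for `√d`.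
  have h1 : ‖v'.1 - v.1‖ ≤ (d + 1 : ℝ) * (2 / K) := by
    rw [EuclideanSpace.norm_eq]
    refine Real.sqrt_le_iff.mpr ⟨by positivity, ?_⟩
    calc ∑ i, ‖(v'.1 - v.1) i‖ ^ 2 ≤ ∑ _i : Fin d, (2 / K : ℝ) ^ 2 := by
          refine Finset.sum_le_sum fun i _ => ?_
          have := hc i
          rw [Real.norm_eq_abs]
          gcongr
          simpa using this
      _ = d * (2 / K : ℝ) ^ 2 := by simp
      _ ≤ (d + 1 : ℝ) ^ 2 * (2 / K : ℝ) ^ 2 := by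
          gcongr
          have : (0 : ℝ) ≤ d := by positivity
          nlinarith
      _ = _ := by ring
  refine h1.trans_lt ?_
  rw [← mul_div_assoc, div_lt_iff₀ hK']
  exact hρ

/-- The unit cubes near the cell `u`. -/
noncomputable def window (d K W : ℕ) (u : ℤ × ℤ) : Finset (Fin d → ℤ) :=
  Finset.Icc (fun i => unitIndex d K u i - W) fun i => unitIndex d K u i + W

lemma mem_window {K W : ℕ} {u : ℤ × ℤ} {z : Fin d → ℤ} :
    z ∈ window d K W u ↔ ∀ i, unitIndex d K u i - W ≤ z i ∧ z i ≤ unitIndex d K u i + W := by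
  simp only [window, Finset.mem_Icc, Pi.le_def]
  exact ⟨fun h i => ⟨h.1 i, h.2 i⟩, fun h => ⟨fun i => (h i).1, fun i => (h i).2⟩⟩

lemma card_window {K W : ℕ} (u : ℤ × ℤ) : (window d K W u).card = (2 * W + 1) ^ d := by
  simp only [window]
  rw [Pi.card_Icc]
  simp only [Int.card_Icc]
  rw [Finset.prod_congr rfl (g := fun _ => 2 * W + 1) (fun i _ => by omega)]
  simp

lemma unitIndex_mem_window {K W : ℕ} (u : ℤ × ℤ) : unitIndex d K u ∈ window d K W u := by
  rw [mem_window]; intro i; omega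

lemma unitIndex_mem_window_of_next {K W : ℕ} (hK : 0 < K) (hW : 1 ≤ W) {u u' : ℤ × ℤ}
    (hu : Next u u') :
    unitIndex d K u' ∈ window d K W u := by
  rw [mem_window]; intro i
  -- One fine step is bounded by `K` fine steps, so the index of the unit cube grows by at most one.
  have hf : fineIndex d u i ≤ fineIndex d u' i ∧ fineIndex d u' i ≤ fineIndex d u i + 1 * K := by
    rcases hu with rfl | rfl <;> simp only [fineIndex] <;> split_ifs <;> omega
  have h1 := Int.ediv_le_ediv (c := (K : ℤ)) (by positivity) hf.1
  have h2 := Int.ediv_le_ediv (c := (K : ℤ)) (by positivity) hf.2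
  rw [Int.add_mul_ediv_right _ _ (by positivity)] at h2
  simp only [unitIndex]
  omega

/-- Moving by `K(2W+1)` cells moves the unit cube by `2W+1`, the width of a window. This gives the
dependence range `L` of the site field. -/
lemma disjoint_window (hd : 2 ≤ d) {K W : ℕ} (hK : 0 < K) {u v : ℤ × ℤ}
    (h : u.1 + (K * (2 * W + 1) : ℕ) ≤ v.1 ∨ u.2 + (K * (2 * W + 1) : ℕ) ≤ v.2)
    {z : Fin d → ℤ} (hu : z ∈ window d K W u) : z ∉ window d K W v := by
  rw [mem_window] at hu ⊢
  have key : ∀ i : Fin d, fineIndex d u i + (2 * W + 1 : ℤ) * K ≤ fineIndex d v i →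
      ¬ ∀ i, unitIndex d K v i - W ≤ z i ∧ z i ≤ unitIndex d K v i + W := by
    intro i hi hv
    have h1 := hu i
    have h2 := hv i
    have h3 := Int.ediv_le_ediv (c := (K : ℤ)) (by positivity) hi
    rw [Int.add_mul_ediv_right _ _ (by positivity)] at h3
    simp only [unitIndex] at h1 h2
    omega
  rcases h with h | h
  · refine key ⟨0, by omega⟩ ?_
    simp only [fineIndex]
    push_cast at h
    simp only [↓reduceIte]
    linarith
  · refine key ⟨1, by omega⟩ ?_
    simp only [fineIndex]
    push_cast at h
    simp only [one_ne_zero, ↓reduceIte]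
    linarith

/-- The mass of a region in terms of relative positions. -/
lemma le_measure_region (Q : Measure M) [IsProbabilityMeasure Q] {K : ℕ} (hK : 0 < K)
    {A : Set M} (u : ℤ × ℤ) :
    ENNReal.ofReal (1 / K) ^ d * Q A ≤ ((volume : Measure (Fin d → unitInterval)).prod Q)
      {x | loc (unitIndex d K u) x ∈ region d K A u} := by
  have hK' : (0 : ℝ) < K := by exact_mod_cast hK
  have hr : ∀ i, ∃ a b : unitInterval, (b - a : ℝ) = 1 / K ∧ ∀ s ∈ Set.Ico a b,
      (fineIndex d u i : ℝ) ≤ K * ((unitIndex d K u i : ℝ) + (s : ℝ)) ∧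
        K * ((unitIndex d K u i : ℝ) + (s : ℝ)) < fineIndex d u i + 1 := by
    intro i
    have e1 : (0 : ℤ) ≤ fineIndex d u i % K := Int.emod_nonneg _ (by positivity)
    have e2 : fineIndex d u i % K + 1 ≤ K := Int.emod_lt_of_pos _ (by positivity)
    have e3 : K * unitIndex d K u i + fineIndex d u i % K = fineIndex d u i :=
      Int.mul_ediv_add_emod _ _
    have e1' : (0 : ℝ) ≤ (fineIndex d u i % K : ℤ) := by exact_mod_cast e1
    have e2' : ((fineIndex d u i % K : ℤ) : ℝ) + 1 ≤ K := by exact_mod_cast e2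
    have e3' : (K : ℝ) * unitIndex d K u i + (fineIndex d u i % K : ℤ) = fineIndex d u i := by
      exact_mod_cast e3
    -- With `r` the residue of the fine index modulo `K`, the cell occupies `[r/K, (r+1)/K)` within
    -- its unit cube.
    refine ⟨⟨(fineIndex d u i % K : ℤ) / K, by positivity, ?_⟩,
      ⟨((fineIndex d u i % K : ℤ) + 1) / K, by positivity, ?_⟩, ?_, ?_⟩
    · rw [div_le_one hK']; linarith
    · rw [div_le_one hK']; exact e2'
    · simp only; ring
    · rintro s ⟨hs1, hs2⟩
      have hs1 : ((fineIndex d u i % K : ℤ) / K : ℝ) ≤ s := hs1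
      have hs2 : (s : ℝ) < ((fineIndex d u i % K : ℤ) + 1) / K := hs2
      rw [div_le_iff₀ hK'] at hs1
      rw [lt_div_iff₀ hK'] at hs2
      constructor <;> linarith
  choose a b hab hs using hr
  calc ENNReal.ofReal (1 / K) ^ d * Q A
      = ((volume : Measure (Fin d → unitInterval)).prod Q)
          ((Set.pi Set.univ fun i => Set.Ico (a i) (b i)) ×ˢ A) := by
        rw [Measure.prod_prod, volume_pi_pi]
        simp [hab]
    _ ≤ _ := by
        refine measure_mono ?_
        rintro ⟨x, p⟩ ⟨hx, hp⟩
        refine ⟨fun i => ?_, hp⟩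
        exact hs i _ (hx i (Set.mem_univ i))

/-- The unit cubes of the window capture the neighbourhood of the points of a cell. -/
lemma lintegral_le_sum_window (Q : Measure M) [IsProbabilityMeasure Q] {K W : ℕ} (hK : 0 < K)
    {A : Set M} {u : ℤ × ℤ} {v : Space d M} (hv : v ∈ region d K A u) {R : ℝ}
    (hW : R + 1 ≤ W) {G : Space d M → ℝ≥0∞} (hG : Measurable G) :
    ∫⁻ w in {w : Space d M | ‖w.1 - v.1‖ ≤ R}, G w ∂(volume.prod Q) ≤
      ∑ z ∈ window d K W u,
        ∫⁻ x, G (loc z x) ∂((volume : Measure (Fin d → unitInterval)).prod Q) := by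
  have hsub : {w : Space d M | ‖w.1 - v.1‖ ≤ R} ⊆ ⋃ z ∈ window d K W u, cube M z := by
    intro w hw
    simp only [Set.mem_iUnion]
    refine ⟨fun i => ⌊w.1 i⌋, ?_, fun i => ⟨Int.floor_le _, (Int.lt_floor_add_one _).le⟩⟩
    rw [mem_window]
    intro i
    have h1 : |w.1 i - v.1 i| ≤ R := by
      have := (PiLp.norm_apply_le (w.1 - v.1) i).trans hw
      simpa using this
    rw [abs_le] at h1
    have h2 := unitIndex_le hK hv i
    constructor
    · rw [Int.le_floor]; push_cast; linarith
    · have : ⌊w.1 i⌋ < unitIndex d K u i + W + 1 := by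
        rw [Int.floor_lt]; push_cast; linarith
      omega
  calc _ ≤ ∫⁻ w in ⋃ z ∈ window d K W u, cube M z, G w ∂(volume.prod Q) :=
        lintegral_mono_set hsub
    _ ≤ ∑ z ∈ window d K W u, ∫⁻ w in cube M z, G w ∂(volume.prod Q) := by
        -- The closed unit cubes overlap on their faces; subadditivity is enough.
        rw [← lintegral_finsetSum_measure]
        refine lintegral_mono' ?_ le_rfl
        refine Measure.le_iff.mpr fun s hs => ?_
        rw [Measure.restrict_apply hs, Measure.finsetSum_apply, Set.inter_iUnion₂]
        refine (measure_biUnion_finset_le _ _).trans_eq ?_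
        exact Finset.sum_congr rfl fun z _ => (Measure.restrict_apply hs).symm
    _ = _ := Finset.sum_congr rfl fun z _ => ((measurePreserving_loc Q z).lintegral_comp hG).symm

end Geometry

/-! ### Probability that two points have no common neighbour -/

section Bridges

set_option linter.unusedSectionVars false

/-- Conditioning on `Y` in the form of Fubini for the product law; used to freeze the positions of
two candidates. -/
lemma measure_le_of_indepFun {Ω α β : Type*} {mΩ : MeasurableSpace Ω} [MeasurableSpace α]
    [MeasurableSpace β] {P : Measure Ω} [IsProbabilityMeasure P] {Y : Ω → α} {Z : Ω → β}
    (hY : Measurable Y) (hZ : Measurable Z) (h : IndepFun Y Z P) {G : Set (α × β)}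
    (hG : MeasurableSet G) {q : ℝ≥0∞} (hq : ∀ y, P {ω | (y, Z ω) ∈ G} ≤ q) :
    P {ω | (Y ω, Z ω) ∈ G} ≤ q := by
  have e := (indepFun_iff_map_prod_eq_prod_map_map hY.aemeasurable hZ.aemeasurable).mp h
  have : IsProbabilityMeasure (P.map Y) := Measure.isProbabilityMeasure_map hY.aemeasurable
  have : IsProbabilityMeasure (P.map Z) := Measure.isProbabilityMeasure_map hZ.aemeasurable
  calc P {ω | (Y ω, Z ω) ∈ G} = P.map (fun ω => (Y ω, Z ω)) G :=
        (Measure.map_apply (hY.prodMk hZ) hG).symm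
    _ = ∫⁻ y, P.map Z (Prod.mk y ⁻¹' G) ∂(P.map Y) := by rw [e, Measure.prod_apply hG]
    _ ≤ ∫⁻ _, q ∂(P.map Y) := by
        refine lintegral_mono fun y => ?_
        rw [Measure.map_apply hZ (measurable_prodMk_left hG)]
        exact hq y
    _ = q := by simp

variable {d : ℕ} {M : Type*} [MeasurableSpace M]

lemma measure_biInter_le_pow (Q : Measure M) [IsProbabilityMeasure Q] (t : ℝ≥0) {κ : Type*}
    (s : Finset κ) {S : κ → Set (CoordIndex d)} {E : κ → Set (Sample d M)} {q : ℝ≥0∞}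
    (hS : ∀ k ∈ s, ∀ l ∈ s, k ≠ l → Disjoint (S k) (S l))
    (hE : ∀ k ∈ s, MeasurableSet[sigmaOf M (S k)] (E k)) (hq : ∀ k ∈ s, law d Q t (E k) ≤ q) :
    law d Q t (⋂ k ∈ s, E k) ≤ q ^ s.card := by
  classical
  induction s using Finset.induction_on with
  | empty => simp
  | insert k s hk ih =>
    have hdis : Disjoint (S k) (⋃ l ∈ s, S l) := by
      simp only [Set.disjoint_iUnion_right]
      intro l hl
      exact hS k (Finset.mem_insert_self _ _) l (Finset.mem_insert_of_mem hl)
        (fun h => hk (h ▸ hl))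
    have hm : MeasurableSet[sigmaOf M (⋃ l ∈ s, S l)] (⋂ l ∈ s, E l) :=
      Finset.measurableSet_biInter _ fun l hl =>
        sigmaOf_mono (Set.subset_biUnion_of_mem (u := S) (by exact hl)) _
          (hE l (Finset.mem_insert_of_mem hl))
    rw [Finset.set_biInter_insert, Finset.card_insert_of_notMem hk, pow_succ']
    rw [(Indep_iff _ _ _).mp (indep_sigmaOf Q t hdis) _ _ (hE k (Finset.mem_insert_self _ _)) hm]
    refine mul_le_mul' (hq k (Finset.mem_insert_self _ _)) (ih ?_ ?_ ?_)
    · intro i hi j hj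
      exact hS i (Finset.mem_insert_of_mem hi) j (Finset.mem_insert_of_mem hj)
    · intro i hi
      exact hE i (Finset.mem_insert_of_mem hi)
    · intro i hi
      exact hq i (Finset.mem_insert_of_mem hi)

lemma indepFun_of_sigmaOf (Q : Measure M) [IsProbabilityMeasure Q] (t : ℝ≥0) {α β : Type*}
    [MeasurableSpace α] [MeasurableSpace β] {Y : Sample d M → α} {Z : Sample d M → β}
    {S T : Set (CoordIndex d)} (hY : Measurable[sigmaOf M S] Y) (hZ : Measurable[sigmaOf M T] Z)
    (h : Disjoint S T) : IndepFun Y Z (law d Q t) := by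
  rw [IndepFun_iff_Indep]
  exact indep_of_indep_of_le (indep_sigmaOf Q t h) hY.comap_le hZ.comap_le

lemma volume_unitInterval_le {c : ℝ} (h0 : 0 ≤ c) (h1 : c ≤ 1) :
    volume {u : unitInterval | (u : ℝ) ≤ c} = ENNReal.ofReal c := by
  have : {u : unitInterval | (u : ℝ) ≤ c} = Set.Iic ⟨c, h0, h1⟩ := rfl
  rw [this, unitInterval.volume_Iic]

lemma ConnectionFunction.measurable_right (φ : ConnectionFunction d M) (v : Space d M) :
    Measurable fun w => φ.toFun v w :=
  φ.measurable.comp (by fun_prop : Measurable fun w : Space d M => (v, w))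

/-- As `a ≠ a'`, the two edge variables are distinct coordinates, hence independent uniforms, and
independent of the position of `b`. Given that position, both inequalities hold with the product of
the two connection probabilities. -/
lemma measure_bridge (φ : ConnectionFunction d M) (Q : Measure M) [IsProbabilityMeasure Q]
    (t : ℝ≥0) (v v' : Space d M) {a a' : Label d} (haa : a ≠ a') (b : Label d) :
    law d Q t {ω | (ω.2.2 s(some a, some b) : ℝ) ≤ φ.toFun v (loc b.1 (ω.2.1 b)) ∧
        (ω.2.2 s(some a', some b) : ℝ) ≤ φ.toFun v' (loc b.1 (ω.2.1 b))} =
      ∫⁻ x, ENNReal.ofReal (φ.toFun v (loc b.1 x)) * ENNReal.ofReal (φ.toFun v' (loc b.1 x))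
        ∂((volume : Measure (Fin d → unitInterval)).prod Q) := by
  have hne : s(some a, some b) ≠ s(some a', some b) := by
    intro h
    rw [Sym2.eq_iff] at h
    simp only [Option.some.injEq, and_true] at h
    rcases h with h | h
    · exact haa h
    · exact haa (h.1.trans h.2)
  let X : Sample d M → (Fin d → unitInterval) × M := fun ω => ω.2.1 b
  let U : Sample d M → unitInterval × unitInterval := fun ω =>
    (ω.2.2 s(some a, some b), ω.2.2 s(some a', some b))
  have hX : Measurable X := by fun_prop
  have hU : Measurable U := by fun_prop
  have hXU : IndepFun X U (law d Q t) := by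
    refine indepFun_of_sigmaOf Q t (S := {Sum.inr (Sum.inl b)})
      (T := {Sum.inr (Sum.inr s(some a, some b)), Sum.inr (Sum.inr s(some a', some b))})
      (measurable_label (by simp)) ((measurable_edge (by simp)).prodMk (measurable_edge (by simp)))
      (by simp)
  have hUU : IndepFun (fun ω : Sample d M => ω.2.2 s(some a, some b))
      (fun ω => ω.2.2 s(some a', some b)) (law d Q t) := by
    refine indepFun_of_sigmaOf Q t (S := {Sum.inr (Sum.inr s(some a, some b))})
      (T := {Sum.inr (Sum.inr s(some a', some b))})
      (measurable_edge (by simp)) (measurable_edge (by simp)) ?_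
    rw [Set.disjoint_singleton]
    simpa using hne
  have hlawU : (law d Q t).map U = (volume : Measure unitInterval).prod volume := by
    have := (indepFun_iff_map_prod_eq_prod_map_map (by fun_prop) (by fun_prop)).mp hUU
    rw [map_edge, map_edge] at this
    exact this
  have hlaw := (indepFun_iff_map_prod_eq_prod_map_map hX.aemeasurable hU.aemeasurable).mp hXU
  rw [hlawU, map_label] at hlaw
  let G : Set (((Fin d → unitInterval) × M) × unitInterval × unitInterval) :=
    {p | (p.2.1 : ℝ) ≤ φ.toFun v (loc b.1 p.1) ∧ (p.2.2 : ℝ) ≤ φ.toFun v' (loc b.1 p.1)}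
  have hf : ∀ v, Measurable fun p : ((Fin d → unitInterval) × M) × unitInterval × unitInterval =>
      φ.toFun v (loc b.1 p.1) := fun v =>
    (φ.measurable_right v).comp ((measurable_loc b.1).comp measurable_fst)
  have hG : MeasurableSet G := (measurableSet_le (by fun_prop) (hf v)).inter
    (measurableSet_le (by fun_prop) (hf v'))
  calc _ = (law d Q t).map (fun ω => (X ω, U ω)) G :=
        (Measure.map_apply (hX.prodMk hU) hG).symm
    _ = _ := by
        rw [hlaw, Measure.prod_apply hG]
        refine lintegral_congr fun x => ?_
        rw [← volume_unitInterval_le (φ.nonneg _ _) (φ.le_one _ _),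
          ← volume_unitInterval_le (φ.nonneg _ _) (φ.le_one _ _), ← Measure.prod_prod]
        rfl

/-- The edge variable of the pair `a, b` admits an edge. -/
def EdgeOpen (φ : ConnectionFunction d M) (ω : Sample d M) (a b : Label d) : Prop :=
  (ω.2.2 s(some a, some b) : ℝ) ≤ φ.toFun (loc a.1 (ω.2.1 a)) (loc b.1 (ω.2.1 b))

/-- It is unlikely that none of `m` candidates in the unit cube `z` is joined to both `a` and
`a'`, when the latter are in a position where one candidate succeeds with probability `c`. -/
lemma measure_no_bridge_le (φ : ConnectionFunction d M) (Q : Measure M) [IsProbabilityMeasure Q]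
    (t : ℝ≥0) {m : ℕ} {a a' : Label d} (haa : a ≠ a') (ha : a.2 < m) (ha' : a'.2 < m)
    (z : Fin d → ℤ) {c : ℝ≥0∞} {B : Set (Space d M × Space d M)} (hB : MeasurableSet B)
    (hBc : ∀ y ∈ B, c ≤ ∫⁻ x, ENNReal.ofReal (φ.toFun y.1 (loc z x)) *
      ENNReal.ofReal (φ.toFun y.2 (loc z x)) ∂((volume : Measure (Fin d → unitInterval)).prod Q)) :
    law d Q t {ω | (loc a.1 (ω.2.1 a), loc a'.1 (ω.2.1 a')) ∈ B ∧ ∀ k < m,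
        ¬ (EdgeOpen φ ω a (z, m + k) ∧ EdgeOpen φ ω a' (z, m + k))} ≤ (1 - c) ^ m := by
  -- These coordinates decide whether connector `k` works. Since `a` and `a'` have index below `m`
  -- and connectors have index at least `m`, the sets are disjoint for different `k` and avoid the
  -- positions of `a` and `a'`.
  let S : ℕ → Set (CoordIndex d) := fun k => {Sum.inr (Sum.inl (z, m + k)),
    Sum.inr (Sum.inr s(some a, some (z, m + k))), Sum.inr (Sum.inr s(some a', some (z, m + k)))}
  have hS : ∀ k l, k ≠ l → Disjoint (S k) (S l) := by
    intro k l hkl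
    have hneb : ((z, m + k) : Label d) ≠ (z, m + l) := by
      intro h; simp only [Prod.mk.injEq, true_and] at h; omega
    have e1 : ∀ l, a ≠ (z, m + l) := fun l h => by rw [h] at ha; simp at ha
    have e2 : ∀ l, a' ≠ (z, m + l) := fun l h => by rw [h] at ha'; simp at ha'
    rw [Set.disjoint_left]
    rintro i hi hi'
    simp only [S, Set.mem_insert_iff, Set.mem_singleton_iff] at hi hi'
    rcases hi with rfl | rfl | rfl
    · simp only [Sum.inr.injEq, Sum.inl.injEq, reduceCtorEq, or_false] at hi'
      exact hneb hi'
    · simp only [Sum.inr.injEq, reduceCtorEq, Sym2.eq_iff, Option.some.injEq, false_or] at hi'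
      rcases hi' with (h | h) | h | h
      · exact hneb h.2
      · exact e1 _ h.1
      · exact hneb h.2
      · exact e1 _ h.1
    · simp only [Sum.inr.injEq, reduceCtorEq, Sym2.eq_iff, Option.some.injEq, false_or] at hi'
      rcases hi' with (h | h) | h | h
      · exact hneb h.2
      · exact e2 _ h.1
      · exact hneb h.2
      · exact e2 _ h.1
  let Y : Sample d M → Space d M × Space d M := fun ω =>
    (loc a.1 (ω.2.1 a), loc a'.1 (ω.2.1 a'))
  let Z : Sample d M → ℕ → ((Fin d → unitInterval) × M) × unitInterval × unitInterval :=
    fun ω k => (ω.2.1 (z, m + k), ω.2.2 s(some a, some (z, m + k)),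
      ω.2.2 s(some a', some (z, m + k)))
  have hYm : Measurable[sigmaOf M {Sum.inr (Sum.inl a), Sum.inr (Sum.inl a')}] Y :=
    ((measurable_loc a.1).comp (measurable_label (by simp))).prodMk
      ((measurable_loc a'.1).comp (measurable_label (by simp)))
  have hZk : ∀ k, Measurable[sigmaOf M (S k)] fun ω => Z ω k := fun k =>
    (measurable_label (by simp [S])).prodMk
      ((measurable_edge (by simp [S])).prodMk (measurable_edge (by simp [S])))
  have hZm : Measurable[sigmaOf M (⋃ k, S k)] Z :=
    @measurable_pi_lambda _ _ _ (sigmaOf M (⋃ k, S k)) _ _ fun k =>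
      (hZk k).mono (sigmaOf_mono (Set.subset_iUnion S k)) le_rfl
  have hYZ : IndepFun Y Z (law d Q t) := by
    refine indepFun_of_sigmaOf Q t hYm hZm ?_
    rw [Set.disjoint_iUnion_right]
    intro k
    have e1 : a ≠ (z, m + k) := fun h => by rw [h] at ha; simp at ha
    have e2 : a' ≠ (z, m + k) := fun h => by rw [h] at ha'; simp at ha'
    rw [Set.disjoint_left]
    rintro i (rfl | rfl) hi <;>
      simp only [S, Set.mem_insert_iff, Set.mem_singleton_iff, Sum.inr.injEq, Sum.inl.injEq,
        reduceCtorEq, or_false] at hi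
    · exact e1 hi
    · exact e2 hi
  let H : (Space d M × Space d M) → ℕ →
      Set (((Fin d → unitInterval) × M) × unitInterval × unitInterval) := fun y k =>
    {p | (p.2.1 : ℝ) ≤ φ.toFun y.1 (loc z p.1) ∧ (p.2.2 : ℝ) ≤ φ.toFun y.2 (loc z p.1)}
  let G : Set ((Space d M × Space d M) ×
      (ℕ → ((Fin d → unitInterval) × M) × unitInterval × unitInterval)) :=
    {p | p.1 ∈ B} ∩ ⋂ k ∈ Finset.range m, {p | p.2 k ∈ H p.1 k}ᶜ
  have hHG : ∀ k, MeasurableSet {p : (Space d M × Space d M) ×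
      (ℕ → ((Fin d → unitInterval) × M) × unitInterval × unitInterval) | p.2 k ∈ H p.1 k} := by
    intro k
    have hl : Measurable fun p : (Space d M × Space d M) ×
      (ℕ → ((Fin d → unitInterval) × M) × unitInterval × unitInterval) => loc z (p.2 k).1 :=
      (measurable_loc z).comp (by fun_prop)
    exact (measurableSet_le (by fun_prop)
        (φ.measurable.comp ((measurable_fst.comp measurable_fst).prodMk hl))).inter
      (measurableSet_le (by fun_prop)
        (φ.measurable.comp ((measurable_snd.comp measurable_fst).prodMk hl)))
  have hG : MeasurableSet G := (measurable_fst hB).inter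
    (Finset.measurableSet_biInter _ fun k _ => (hHG k).compl)
  -- With the endpoints frozen at `y`, the `m` connectors fail independently, each with probability
  -- at most `1 - c`.
  have hbound : ∀ y, law d Q t {ω | (y, Z ω) ∈ G} ≤ (1 - c) ^ m := by
    intro y
    by_cases hy : y ∈ B
    · have hsub : {ω | (y, Z ω) ∈ G} ⊆ ⋂ k ∈ Finset.range m, {ω | Z ω k ∈ H y k}ᶜ := by
        intro ω hω
        have := hω.2
        simpa using this
      have hHm : ∀ k, MeasurableSet (H y k) := fun k =>
        (measurableSet_le (by fun_prop)
          ((φ.measurable_right y.1).comp ((measurable_loc z).comp measurable_fst))).inter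
        (measurableSet_le (by fun_prop)
          ((φ.measurable_right y.2).comp ((measurable_loc z).comp measurable_fst)))
      refine (measure_mono hsub).trans ?_
      refine (measure_biInter_le_pow Q t (Finset.range m) (S := S) (q := 1 - c)
        (fun k _ l _ => hS k l) (fun k _ => MeasurableSet.compl (hZk k (hHm k)))
        fun k _ => ?_).trans_eq (by rw [Finset.card_range])
      rw [prob_compl_eq_one_sub (sigmaOf_le (S k) _ (hZk k (hHm k)))]
      refine tsub_le_tsub_left ?_ _
      refine (hBc y hy).trans_eq ?_
      exact (measure_bridge φ Q t y.1 y.2 haa (z, m + k)).symm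
    · have : {ω | (y, Z ω) ∈ G} = ∅ := by
        ext ω
        simp only [Set.mem_ofPred_eq, Set.mem_empty_iff_false, iff_false]
        exact fun h => hy h.1
      rw [this, measure_empty]
      exact bot_le
  refine (measure_mono ?_).trans (measure_le_of_indepFun (hYm.mono (sigmaOf_le _) le_rfl)
    (hZm.mono (sigmaOf_le _) le_rfl) hYZ hG hbound)
  rintro ω ⟨h1, h2⟩
  refine ⟨h1, ?_⟩
  simp only [Set.mem_iInter, Finset.mem_range]
  exact h2

end Bridges

/-! ### Good and bad sites of the planar lattice -/

section Sites

set_option linter.unusedSectionVars false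

open Filter Topology

variable {d : ℕ} {M : Type*} [MeasurableSpace M]

/-- The `j`-th point of its unit cube lies over the cell `u` and has its mark in `A`. -/
def Candidate (K : ℕ) (A : Set M) (ω : Sample d M) (u : ℤ × ℤ) (j : ℕ) : Prop :=
  loc (unitIndex d K u) (ω.2.1 (unitIndex d K u, j)) ∈ region d K A u

/-- The candidates `j` of `u` and `j'` of `u'` have no common neighbour in the window of `u`. -/
def Unbridged (φ : ConnectionFunction d M) (A : Set M) (K W m : ℕ) (u u' : ℤ × ℤ) (j j' : ℕ) :
    Set (Sample d M) :=
  {ω | Candidate K A ω u j ∧ Candidate K A ω u' j' ∧ ∀ z ∈ window d K W u, ∀ k < m,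
    ¬ (EdgeOpen φ ω (unitIndex d K u, j) (z, m + k) ∧
      EdgeOpen φ ω (unitIndex d K u', j') (z, m + k))}

/-- The site `u` is bad: there are too few points nearby, or no candidates, or candidates
which are not joined to some candidate of the next sites. -/
def BadSite (φ : ConnectionFunction d M) (A : Set M) (K W m : ℕ) (u : ℤ × ℤ) :
    Set (Sample d M) :=
  (⋃ z ∈ window d K W u, {ω | ω.1 z < 2 * m}) ∪
  (⋂ j ∈ Finset.range m, {ω | Candidate K A ω u j}ᶜ) ∪
  ⋃ u' ∈ ({(u.1 + 1, u.2), (u.1, u.2 + 1)} : Finset (ℤ × ℤ)), ⋃ j ∈ Finset.range m,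
    ⋃ j' ∈ Finset.range m, Unbridged φ A K W m u u' j j'

/-- The coordinates of the sample with labels in the window of `u`. -/
def coordSupport (d K W : ℕ) (u : ℤ × ℤ) : Set (CoordIndex d) :=
  {i | (∃ z ∈ window d K W u, i = Sum.inl z) ∨
    (∃ a : Label d, a.1 ∈ window d K W u ∧ i = Sum.inr (Sum.inl a)) ∨
    ∃ a b : Label d, a.1 ∈ window d K W u ∧ b.1 ∈ window d K W u ∧
      i = Sum.inr (Sum.inr s(some a, some b))}

lemma disjoint_coordSupport (hd : 2 ≤ d) {K W : ℕ} (hK : 0 < K) {u v : ℤ × ℤ}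
    (h : u.1 + (K * (2 * W + 1) : ℕ) ≤ v.1 ∨ u.2 + (K * (2 * W + 1) : ℕ) ≤ v.2) :
    Disjoint (coordSupport d K W u) (coordSupport d K W v) := by
  have hw : ∀ z ∈ window d K W u, z ∉ window d K W v := fun z hz => disjoint_window hd hK h hz
  rw [Set.disjoint_left]
  rintro i (⟨z, hz, rfl⟩ | ⟨a, ha, rfl⟩ | ⟨a, b, ha, hb, rfl⟩)
    (⟨z', hz', hi⟩ | ⟨a', ha', hi⟩ | ⟨a', b', ha', hb', hi⟩) <;>
    simp only [reduceCtorEq, Sum.inl.injEq, Sum.inr.injEq, Sym2.eq_iff, Option.some.injEq] at hi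
  · exact hw z hz (hi ▸ hz')
  · exact hw _ ha (hi ▸ ha')
  · rcases hi with hi | hi
    · exact hw _ ha (hi.1 ▸ ha')
    · exact hw _ ha (hi.1 ▸ hb')

lemma measurableSet_candidate {S : Set (CoordIndex d)} {K : ℕ} {A : Set M} (hA : MeasurableSet A)
    {u : ℤ × ℤ} {j : ℕ} (h : Sum.inr (Sum.inl (unitIndex d K u, j)) ∈ S) :
    MeasurableSet[sigmaOf M S] {ω : Sample d M | Candidate K A ω u j} :=
  ((measurable_loc _).comp (measurable_label h)) (measurableSet_region hA u)

lemma measurableSet_edgeOpen (φ : ConnectionFunction d M) {S : Set (CoordIndex d)} {a b : Label d}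
    (ha : Sum.inr (Sum.inl a) ∈ S) (hb : Sum.inr (Sum.inl b) ∈ S)
    (hab : Sum.inr (Sum.inr s(some a, some b)) ∈ S) :
    MeasurableSet[sigmaOf M S] {ω : Sample d M | EdgeOpen φ ω a b} :=
  measurableSet_le
    (measurable_subtype_coe.comp (measurable_edge hab))
    (φ.measurable.comp (((measurable_loc _).comp (measurable_label ha)).prodMk
      ((measurable_loc _).comp (measurable_label hb))))

lemma measurableSet_badSite (φ : ConnectionFunction d M) {A : Set M} (hA : MeasurableSet A)
    {K W : ℕ} (hK : 0 < K) (hW : 1 ≤ W) (m : ℕ) (u : ℤ × ℤ) :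
    MeasurableSet[sigmaOf M (coordSupport d K W u)] (BadSite φ A K W m u) := by
  have hlab : ∀ a : Label d, a.1 ∈ window d K W u →
      Sum.inr (Sum.inl a) ∈ coordSupport d K W u := fun a ha => Or.inr (Or.inl ⟨a, ha, rfl⟩)
  have hedge : ∀ a b : Label d, a.1 ∈ window d K W u → b.1 ∈ window d K W u →
      Sum.inr (Sum.inr s(some a, some b)) ∈ coordSupport d K W u :=
    fun a b ha hb => Or.inr (Or.inr ⟨a, b, ha, hb, rfl⟩)
  refine MeasurableSet.union (MeasurableSet.union ?_ ?_) ?_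
  · refine Finset.measurableSet_biUnion _ fun z hz => ?_
    exact measurable_count (Or.inl ⟨z, hz, rfl⟩) (measurableSet_Iio (a := 2 * m))
  · refine Finset.measurableSet_biInter _ fun j _ => MeasurableSet.compl ?_
    exact measurableSet_candidate hA (hlab _ (unitIndex_mem_window u))
  · refine Finset.measurableSet_biUnion _ fun u' hu' => ?_
    have hu' : Next u u' := by simpa [Next] using hu'
    have h0 := unitIndex_mem_window (d := d) (K := K) (W := W) u
    have h1 := unitIndex_mem_window_of_next (d := d) hK hW hu'
    refine Finset.measurableSet_biUnion _ fun j _ => Finset.measurableSet_biUnion _ fun j' _ => ?_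
    have e : Unbridged φ A K W m u u' j j' = {ω | Candidate K A ω u j} ∩
        ({ω | Candidate K A ω u' j'} ∩ ⋂ z ∈ window d K W u, ⋂ k ∈ Finset.range m,
          ({ω | EdgeOpen φ ω (unitIndex d K u, j) (z, m + k)} ∩
            {ω | EdgeOpen φ ω (unitIndex d K u', j') (z, m + k)})ᶜ) := by
      ext ω
      simp [Unbridged]
    rw [e]
    refine (measurableSet_candidate hA (hlab _ h0)).inter
      ((measurableSet_candidate hA (hlab _ h1)).inter ?_)
    refine Finset.measurableSet_biInter _ fun z hz => Finset.measurableSet_biInter _ fun k _ => ?_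
    refine MeasurableSet.compl ?_
    exact (measurableSet_edgeOpen φ (hlab _ h0) (hlab _ hz) (hedge _ _ h0 hz)).inter
      (measurableSet_edgeOpen φ (hlab _ h1) (hlab _ hz) (hedge _ _ h1 hz))

/-- Points that are close and have marks in `A` have at least `c` expected common neighbours per
unit of intensity at distance at most `R`. -/
def TwoStep (φ : ConnectionFunction d M) (Q : Measure M) (A : Set M) (ρ R c : ℝ) : Prop :=
  ∀ v v' : Space d M, v.2 ∈ A → v'.2 ∈ A → ‖v'.1 - v.1‖ < ρ →
    ENNReal.ofReal c ≤ ∫⁻ w in {w : Space d M | ‖w.1 - v.1‖ ≤ R},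
      ENNReal.ofReal (φ.toFun v w) * ENNReal.ofReal (φ.toFun v' w) ∂(volume.prod Q)

variable (Q : Measure M) [IsProbabilityMeasure Q]

/-- The two-step integral is at most a sum over the `n = (2W+1)^d` cubes of the window, so some cube
carries at least `c / n`. Which cube does so depends on the random positions, hence the union bound
over the window. -/
lemma measure_unbridged_le (hd : 2 ≤ d) (φ : ConnectionFunction d M) {A : Set M}
    {ρ R c : ℝ} (h : TwoStep φ Q A ρ R c) {K W : ℕ} (hK : 0 < K)
    (hKρ : (d + 1 : ℝ) * 2 < ρ * K) (hWR : R + 1 ≤ W) (t : ℝ≥0)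
    {m : ℕ} {u u' : ℤ × ℤ} (hu : Next u u') {j j' : ℕ} (hj : j < m) (hj' : j' < m) :
    law d Q t (Unbridged φ A K W m u u' j j') ≤
      ((2 * W + 1) ^ d : ℕ) * (1 - ENNReal.ofReal c / ((2 * W + 1) ^ d : ℕ)) ^ m := by
  have huu : u ≠ u' := by
    rintro rfl
    rcases hu with h | h <;> simp [Prod.ext_iff] at h
  -- Neighbouring cells may lie in one unit cube, so the labels can coincide; but a single point
  -- cannot lie over two cells.
  by_cases haa : ((unitIndex d K u, j) : Label d) = (unitIndex d K u', j')
  · have : Unbridged φ A K W m u u' j j' = ∅ := by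
      ext ω
      simp only [Unbridged, Set.mem_ofPred_eq, Set.mem_empty_iff_false, iff_false]
      rintro ⟨h1, h2, -⟩
      simp only [Prod.mk.injEq] at haa
      simp only [Candidate] at h1 h2
      rw [← haa.1, ← haa.2] at h2
      exact huu (eq_of_mem_region hd h1 h2)
    rw [this, measure_empty]
    exact bot_le
  set n : ℕ := (2 * W + 1) ^ d with hn
  have hn0 : (n : ℝ≥0∞) ≠ 0 := by
    rw [Nat.cast_ne_zero, hn]; positivity
  let I : (Fin d → ℤ) → Space d M × Space d M → ℝ≥0∞ := fun z y =>
    ∫⁻ x, ENNReal.ofReal (φ.toFun y.1 (loc z x)) * ENNReal.ofReal (φ.toFun y.2 (loc z x))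
      ∂((volume : Measure (Fin d → unitInterval)).prod Q)
  have hI : ∀ z, Measurable (I z) := by
    intro z
    have h1 : Measurable fun p : (Space d M × Space d M) × (Fin d → unitInterval) × M =>
        φ.toFun p.1.1 (loc z p.2) :=
      φ.measurable.comp ((measurable_fst.comp measurable_fst).prodMk
        ((measurable_loc z).comp measurable_snd))
    have h2 : Measurable fun p : (Space d M × Space d M) × (Fin d → unitInterval) × M =>
        φ.toFun p.1.2 (loc z p.2) :=
      φ.measurable.comp ((measurable_snd.comp measurable_fst).prodMk
        ((measurable_loc z).comp measurable_snd))
    exact (h1.ennreal_ofReal.mul h2.ennreal_ofReal).lintegral_prod_right'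
  let B : (Fin d → ℤ) → Set (Space d M × Space d M) := fun z => {y | ENNReal.ofReal c / n ≤ I z y}
  have hB : ∀ z, MeasurableSet (B z) := fun z => measurableSet_le measurable_const (hI z)
  have hcover : ∀ v ∈ region d K A u, ∀ v' ∈ region d K A u', ∃ z ∈ window d K W u,
      (v, v') ∈ B z := by
    intro v hv v' hv'
    have h1 := h v v' hv.2 hv'.2 (norm_sub_lt_of_next hK hu hv hv' hKρ)
    have h2 := h1.trans (lintegral_le_sum_window Q hK hv hWR
      ((φ.measurable_right v).ennreal_ofReal.mul (φ.measurable_right v').ennreal_ofReal))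
    obtain ⟨z, hz, hmax⟩ := Finset.exists_max_image (window d K W u) (fun z => I z (v, v'))
      ⟨_, unitIndex_mem_window u⟩
    refine ⟨z, hz, ?_⟩
    refine ENNReal.div_le_of_le_mul ?_
    refine h2.trans ((Finset.sum_le_card_nsmul _ _ _ hmax).trans_eq ?_)
    rw [card_window, nsmul_eq_mul, mul_comm]
  have hsub : Unbridged φ A K W m u u' j j' ⊆ ⋃ z ∈ window d K W u,
      {ω | (loc (unitIndex d K u) (ω.2.1 (unitIndex d K u, j)),
        loc (unitIndex d K u') (ω.2.1 (unitIndex d K u', j'))) ∈ B z ∧ ∀ k < m,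
        ¬ (EdgeOpen φ ω (unitIndex d K u, j) (z, m + k) ∧
          EdgeOpen φ ω (unitIndex d K u', j') (z, m + k))} := by
    rintro ω ⟨h1, h2, h3⟩
    obtain ⟨z, hz, hzB⟩ := hcover _ h1 _ h2
    simp only [Set.mem_iUnion]
    exact ⟨z, hz, hzB, h3 z hz⟩
  calc _ ≤ ∑ z ∈ window d K W u, _ := (measure_mono hsub).trans (measure_biUnion_finset_le _ _)
    _ ≤ ∑ z ∈ window d K W u, (1 - ENNReal.ofReal c / n) ^ m := by
        refine Finset.sum_le_sum fun z _ => ?_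
        exact measure_no_bridge_le φ Q t haa hj hj' z (hB z) fun y hy => hy
    _ = _ := by rw [Finset.sum_const, card_window, nsmul_eq_mul]

lemma measure_no_candidate_le {K : ℕ} (hK : 0 < K) {A : Set M} (hA : MeasurableSet A)
    (t : ℝ≥0) (m : ℕ) (u : ℤ × ℤ) :
    law d Q t (⋂ j ∈ Finset.range m, {ω | Candidate K A ω u j}ᶜ) ≤
      (1 - ENNReal.ofReal (1 / K) ^ d * Q A) ^ m := by
  have hc : ∀ j, MeasurableSet[sigmaOf M {Sum.inr (Sum.inl (unitIndex d K u, j))}]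
      {ω : Sample d M | Candidate K A ω u j} := fun j => measurableSet_candidate hA (by simp)
  refine (measure_biInter_le_pow Q t (Finset.range m)
    (S := fun j => {Sum.inr (Sum.inl (unitIndex d K u, j))}) ?_
    (fun j _ => MeasurableSet.compl (hc j)) fun j _ => ?_).trans_eq (by rw [Finset.card_range])
  · intro j _ k _ hjk
    simpa using hjk
  · rw [prob_compl_eq_one_sub (sigmaOf_le _ _ (hc j))]
    refine tsub_le_tsub_left ((le_measure_region Q hK u).trans_eq ?_) _
    rw [← map_label Q t (unitIndex d K u, j)]
    exact Measure.map_apply (by fun_prop) (measurable_loc _ (measurableSet_region hA u))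

lemma tendsto_poissonMeasure_lt (N : ℕ) :
    Tendsto (fun t : ℝ≥0 => poissonMeasure t {n | n < N}) atTop (𝓝 0) := by
  have hle : ∀ t : ℝ≥0, poissonMeasure t {n | n < N} ≤
      ∑ n ∈ Finset.range N, ENNReal.ofReal (Real.exp (-t) * t ^ n / n.factorial) := by
    intro t
    have e : {n | n < N} = ⋃ n ∈ Finset.range N, {n} := by ext n; simp
    rw [e]
    refine (measure_biUnion_finset_le _ _).trans_eq ?_
    exact Finset.sum_congr rfl fun n _ => poissonMeasure_singleton t n
  refine tendsto_of_tendsto_of_tendsto_of_le_of_le tendsto_const_nhds ?_ (fun _ => bot_le) hle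
  have : (0 : ℝ≥0∞) = ∑ n ∈ Finset.range N, 0 := by simp
  rw [this]
  refine tendsto_finsetSum _ fun n _ => ?_
  have h1 := ((Real.tendsto_pow_mul_exp_neg_atTop_nhds_zero n).div_const (n.factorial : ℝ)).comp
    (NNReal.tendsto_coe_atTop.mpr tendsto_id)
  rw [zero_div] at h1
  have h2 := ENNReal.tendsto_ofReal h1
  rw [ENNReal.ofReal_zero] at h2
  refine h2.congr fun t => ?_
  simp [mul_comm]

/-- For `m` and then `t` large, all sites are bad with small probability. -/
lemma exists_measure_badSite_le (hd : 2 ≤ d) (φ : ConnectionFunction d M) {A : Set M}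
    (hA : MeasurableSet A) (hQA : 0 < Q A) {ρ R c : ℝ} (hc : 0 < c) (h : TwoStep φ Q A ρ R c)
    {K W : ℕ} (hK : 0 < K) (hKρ : (d + 1 : ℝ) * 2 < ρ * K) (hWR : R + 1 ≤ W) {q : ℝ≥0∞}
    (hq : 0 < q) :
    ∃ (m : ℕ) (T : ℝ≥0), ∀ t ≥ T, ∀ u, law d Q t (BadSite φ A K W m u) ≤ q := by
  set n : ℕ := (2 * W + 1) ^ d with hn
  have hn0 : (n : ℝ≥0∞) ≠ 0 := by
    rw [Nat.cast_ne_zero, hn]; positivity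
  set x : ℝ≥0∞ := 1 - ENNReal.ofReal (1 / K) ^ d * Q A with hx
  set y : ℝ≥0∞ := 1 - ENNReal.ofReal c / n with hy
  have hK' : (0 : ℝ) < K := by exact_mod_cast hK
  have hx1 : x < 1 := by
    refine ENNReal.sub_lt_self ENNReal.one_ne_top one_ne_zero (mul_ne_zero ?_ hQA.ne')
    refine pow_ne_zero _ ?_
    simpa using hK.ne'
  have hy1 : y < 1 := by
    refine ENNReal.sub_lt_self ENNReal.one_ne_top one_ne_zero ?_
    rw [Ne, ENNReal.div_eq_zero_iff, not_or]
    exact ⟨by simpa using hc, ENNReal.natCast_ne_top _⟩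
  -- The terms bound the absence of candidates and the failure to connect: two neighbours, `m * m`
  -- pairs of candidates, `n` cubes. Neither event involves the Poisson counts, so `m` is chosen
  -- before `t`, which only has to make counts below `2m` unlikely.
  have hlim1 : Tendsto (fun m : ℕ => x ^ m + 2 * (m * (m * (n * y ^ m)))) atTop (𝓝 0) := by
    have hyr : y = ENNReal.ofReal y.toReal := (ENNReal.ofReal_toReal (hy1.trans_le le_top).ne).symm
    have h1 : Tendsto (fun m : ℕ => 2 * ((m : ℝ) * (m * (n * y.toReal ^ m)))) atTop (𝓝 0) := by
      have h3 : y.toReal < 1 := by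
        rw [← ENNReal.toReal_one]
        exact (ENNReal.toReal_lt_toReal (hy1.trans_le le_top).ne ENNReal.one_ne_top).mpr hy1
      have := (tendsto_pow_const_mul_const_pow_of_lt_one 2 ENNReal.toReal_nonneg h3).const_mul
        (2 * n : ℝ)
      rw [mul_zero] at this
      refine this.congr fun m => ?_
      ring
    have h2 : Tendsto (fun m : ℕ => 2 * ((m : ℝ≥0∞) * (m * (n * y ^ m)))) atTop (𝓝 0) := by
      have := ENNReal.tendsto_ofReal h1
      rw [ENNReal.ofReal_zero] at this
      refine this.congr fun m => ?_
      rw [ENNReal.ofReal_mul (by norm_num), ENNReal.ofReal_mul (by positivity),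
        ENNReal.ofReal_mul (by positivity), ENNReal.ofReal_mul (by positivity),
        ENNReal.ofReal_pow (by positivity), ← hyr]
      simp
    simpa using (ENNReal.tendsto_pow_atTop_nhds_zero_of_lt_one hx1).add h2
  have hq2 : 0 < q / 2 := ENNReal.half_pos hq.ne'
  obtain ⟨m, hm⟩ := (hlim1.eventually (ge_mem_nhds hq2)).exists
  have hlim2 : Tendsto (fun t : ℝ≥0 => (n : ℝ≥0∞) * poissonMeasure t {k | k < 2 * m}) atTop
      (𝓝 0) := by
    simpa using ENNReal.Tendsto.const_mul (tendsto_poissonMeasure_lt (2 * m))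
      (Or.inr (ENNReal.natCast_ne_top n))
  obtain ⟨T, hT⟩ := eventually_atTop.mp (hlim2.eventually (ge_mem_nhds hq2))
  refine ⟨m, T, fun t ht u => ?_⟩
  have b1 : law d Q t (⋃ z ∈ window d K W u, {ω | ω.1 z < 2 * m}) ≤ q / 2 := by
    refine (measure_biUnion_finset_le _ _).trans (le_trans ?_ (hT t ht))
    have e : ∀ z, law d Q t {ω | ω.1 z < 2 * m} = poissonMeasure t {k | k < 2 * m} := by
      intro z
      rw [← map_count (M := M) Q t z, Measure.map_apply (by fun_prop) (MeasurableSet.of_discrete)]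
      rfl
    simp only [e, Finset.sum_const, card_window, nsmul_eq_mul, ← hn, le_refl]
  have b2 : law d Q t (⋃ u' ∈ ({(u.1 + 1, u.2), (u.1, u.2 + 1)} : Finset (ℤ × ℤ)),
      ⋃ j ∈ Finset.range m, ⋃ j' ∈ Finset.range m, Unbridged φ A K W m u u' j j') ≤
        2 * (m * (m * (n * y ^ m))) := by
    calc _ ≤ ∑ u' ∈ ({(u.1 + 1, u.2), (u.1, u.2 + 1)} : Finset (ℤ × ℤ)),
          ∑ j ∈ Finset.range m, ∑ j' ∈ Finset.range m,
            law d Q t (Unbridged φ A K W m u u' j j') := by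
          refine (measure_biUnion_finset_le _ _).trans (Finset.sum_le_sum fun u' _ => ?_)
          refine (measure_biUnion_finset_le _ _).trans (Finset.sum_le_sum fun j _ => ?_)
          exact measure_biUnion_finset_le _ _
      _ ≤ ∑ u' ∈ ({(u.1 + 1, u.2), (u.1, u.2 + 1)} : Finset (ℤ × ℤ)),
          ∑ j ∈ Finset.range m, ∑ j' ∈ Finset.range m, n * y ^ m := by
          refine Finset.sum_le_sum fun u' hu' => Finset.sum_le_sum fun j hj =>
            Finset.sum_le_sum fun j' hj' => ?_
          exact measure_unbridged_le Q hd φ h hK hKρ hWR t (by simpa [Next] using hu')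
            (Finset.mem_range.mp hj) (Finset.mem_range.mp hj')
      _ = _ := by
          have : ((u.1 + 1, u.2) : ℤ × ℤ) ≠ (u.1, u.2 + 1) := by simp
          simp only [Finset.sum_const, Finset.card_range, nsmul_eq_mul, Finset.card_pair this]
          push_cast
          rfl
  calc law d Q t (BadSite φ A K W m u) ≤ q / 2 + x ^ m + 2 * (m * (m * (n * y ^ m))) := by
        refine (measure_union_le _ _).trans (add_le_add ?_ b2)
        exact (measure_union_le _ _).trans (add_le_add b1 (measure_no_candidate_le Q hK hA t m u))
    _ ≤ q / 2 + q / 2 := by rw [add_assoc]; gcongr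
    _ = q := ENNReal.add_halves q

end Sites

/-! ### From good sites to infinite clusters -/

section Percolation

set_option linter.unusedSectionVars false

open Filter Topology

variable {d : ℕ} {M : Type*} [MeasurableSpace M]

/-- Goodness of `u` alone suffices, given a candidate at `u'`. Every cube of the window has at least
`2m` points, so candidates and connectors are actual vertices, and the connector gives a path of
length two. -/
lemma reachable_of_candidate (φ : ConnectionFunction d M) {A : Set M} {K W m : ℕ} (hK : 0 < K)
    (hW : 1 ≤ W) (v : Space d M) {ω : Sample d M} {u u' : ℤ × ℤ} (hu : Next u u')
    (hbad : ω ∉ BadSite φ A K W m u) {j j' : ℕ} (hj : j < m) (hj' : j' < m)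
    (h : Candidate K A ω u j) (h' : Candidate K A ω u' j') :
    (graph φ v ω).Reachable (some (unitIndex d K u, j)) (some (unitIndex d K u', j')) := by
  simp only [BadSite, Set.mem_union, not_or] at hbad
  obtain ⟨⟨h1, -⟩, h3⟩ := hbad
  simp only [Set.mem_iUnion, not_exists, Set.mem_ofPred_eq, not_lt] at h1
  have h3' : ω ∉ Unbridged φ A K W m u u' j j' := by
    intro hmem
    apply h3
    simp only [Set.mem_iUnion]
    exact ⟨u', by simpa [Next] using hu, j, by simpa using hj, j', by simpa using hj', hmem⟩
  simp only [Unbridged, Set.mem_ofPred_eq, not_and] at h3'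
  have h4 := h3' h h'
  push Not at h4
  obtain ⟨z, hz, k, hk, e1, e2⟩ := h4
  have hadj : ∀ a : Label d, a.1 ∈ window d K W u → a.2 < m → EdgeOpen φ ω a (z, m + k) →
      (graph φ v ω).Adj (some a) (some (z, m + k)) := by
    intro a ha ham he
    refine ⟨?_, ?_, ?_, he⟩
    · intro hh
      rw [Option.some.inj hh] at ham
      simp at ham
    · have := h1 _ ha
      show a.2 < ω.1 a.1
      omega
    · have := h1 _ hz
      show m + k < ω.1 z
      omega
  exact (hadj _ (unitIndex_mem_window u) hj e1).reachable.trans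
    (hadj _ (unitIndex_mem_window_of_next hK hW hu) hj' e2).reachable.symm

/-- On the percolation event for the sites, every candidate of the origin is connected with
infinitely many vertices. -/
lemma infinite_reachable (hd : 2 ≤ d) (φ : ConnectionFunction d M) {A : Set M} {K W m L : ℕ}
    (hK : 0 < K) (hW : 1 ≤ W) (hL : 1 ≤ L) (v : Space d M) {ω : Sample d M}
    (hω : ∀ n, ∀ i < 2 * L + 1, ¬ BadBox L (fun u => ω ∈ BadSite φ A K W m u) n ((i : ℕ), 0))
    {j : ℕ} (hj : j < m) (h : Candidate K A ω 0 j) :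
    {a | (graph φ v ω).Reachable (some (unitIndex d K 0, j)) a}.Infinite := by
  -- One candidate is selected for each good site, with the one at the origin prescribed to be `j`;
  -- the value at bad sites is irrelevant.
  have hrep : ∀ u : ℤ × ℤ, ∃ i : ℕ,
      (ω ∉ BadSite φ A K W m u → i < m ∧ Candidate K A ω u i) ∧ (u = 0 → i = j) := by
    intro u
    by_cases hu : u = 0
    · subst hu
      exact ⟨j, fun _ => ⟨hj, h⟩, fun _ => rfl⟩
    · by_cases hb : ω ∈ BadSite φ A K W m u
      · exact ⟨0, fun hb' => absurd hb hb', fun h0 => absurd h0 hu⟩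
      · have hb' := hb
        simp only [BadSite, Set.mem_union, not_or] at hb'
        have h2 := hb'.1.2
        simp only [Set.mem_iInter, Set.mem_compl_iff, Set.mem_ofPred_eq, Finset.mem_range,
          not_forall, not_not] at h2
        obtain ⟨i, hi, hc⟩ := h2
        exact ⟨i, fun _ => ⟨hi, hc⟩, fun h0 => absurd h0 hu⟩
  choose rep hrep hrep0 using hrep
  let vert : ℤ × ℤ → Option (Label d) := fun u => some (unitIndex d K u, rep u)
  have hstep : ∀ u u' : ℤ × ℤ, Next u u' → ω ∉ BadSite φ A K W m u → ω ∉ BadSite φ A K W m u' →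
      (graph φ v ω).Reachable (vert u) (vert u') := fun u u' hu hb hb' =>
    reachable_of_candidate φ hK hW v hu hb (hrep u hb).1 (hrep u' hb').1 (hrep u hb).2
      (hrep u' hb').2
  have hinf := infinite_of_forall_not_badBox hL
    (r := fun u u' => (graph φ v ω).Reachable (vert u) (vert u'))
    ⟨fun _ => SimpleGraph.Reachable.refl _, fun h => h.symm, fun h h' => h.trans h'⟩
    (fun u hb hb' => hstep u _ (Or.inl rfl) hb hb')
    (fun u hb hb' => hstep u _ (Or.inr rfl) hb hb') hω
  have hinj : Set.InjOn vert {u | ω ∉ BadSite φ A K W m u ∧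
      (graph φ v ω).Reachable (vert 0) (vert u)} := by
    -- Representatives of different sites differ because a point determines its cell.
    rintro u ⟨hu, -⟩ u' ⟨hu', -⟩ huu
    have e := Option.some.inj huu
    simp only [Prod.mk.injEq] at e
    have c1 := (hrep u hu).2
    have c2 := (hrep u' hu').2
    simp only [Candidate] at c1 c2
    rw [← e.1, ← e.2] at c2
    exact eq_of_mem_region hd c1 c2
  refine (hinf.image hinj).mono ?_
  rintro _ ⟨u, ⟨-, hu⟩, rfl⟩
  have e0 : vert 0 = some (unitIndex d K 0, j) := by simp only [vert, hrep0 0 rfl]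
  rw [← e0]
  exact hu

variable (Q : Measure M) [IsProbabilityMeasure Q]

/-- If the cluster of a typical extra vertex is finite, then the extra vertex is not joined to
a given point belonging to an infinite cluster. -/
lemma measure_inter_connected_eq_zero (φ : ConnectionFunction d M) (t : ℝ≥0) {v : Space d M}
    (hv : ∀ᵐ ω ∂(law d Q t), (cluster φ v ω).Finite) {a : Label d} {D : Set (Sample d M)}
    (hD : MeasurableSet[sigmaOf M {Sum.inr (Sum.inr s(none, some a))}ᶜ] D)
    (hDv : ∀ ω ∈ D, IsVertex ω (some a))
    (hDi : ∀ ω ∈ D, {b | (graph φ v ω).Reachable (some a) b}.Infinite) :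
    ∀ᵐ ω ∂(law d Q t), ω ∈ D → φ.toFun v (loc a.1 (ω.2.1 a)) = 0 := by
  have hn : ∀ n : ℕ, law d Q t
      (D ∩ {ω | 1 / ((n : ℝ) + 1) ≤ φ.toFun v (loc a.1 (ω.2.1 a))}) = 0 := by
    intro n
    set E := D ∩ {ω : Sample d M | 1 / ((n : ℝ) + 1) ≤ φ.toFun v (loc a.1 (ω.2.1 a))} with hE
    -- The connection probability depends on `ω`, so the edge event is replaced by a fixed
    -- threshold. Then `F` is independent of `E` and has positive probability, while `E ∩ F` forces
    -- an infinite cluster of `none`.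
    set F := {ω : Sample d M | (ω.2.2 s(none, some a) : ℝ) ≤ 1 / ((n : ℝ) + 1)} with hF
    have hEm : MeasurableSet[sigmaOf M {Sum.inr (Sum.inr s(none, some a))}ᶜ] E :=
      hD.inter (measurableSet_le measurable_const ((φ.measurable_right v).comp
        ((measurable_loc a.1).comp (measurable_label (by simp)))))
    have hFm : MeasurableSet[sigmaOf M {Sum.inr (Sum.inr s(none, some a))}] F :=
      measurableSet_le (measurable_subtype_coe.comp (measurable_edge (by simp))) measurable_const
    have hEF : law d Q t (E ∩ F) = 0 := by
      refine measure_mono_null ?_ (ae_iff.mp hv)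
      rintro ω ⟨⟨h1, h2⟩, h3⟩
      have hadj : (graph φ v ω).Adj none (some a) :=
        ⟨by simp, trivial, hDv ω h1, le_trans h3 h2⟩
      exact (hDi ω h1).mono fun b hb => hadj.reachable.trans hb
    rw [(Indep_iff _ _ _).mp (indep_sigmaOf Q t disjoint_compl_left) _ _ hEm hFm,
      mul_eq_zero] at hEF
    refine hEF.resolve_right ?_
    have hpos : (0 : ℝ) < 1 / ((n : ℝ) + 1) := by positivity
    have hle : 1 / ((n : ℝ) + 1) ≤ 1 := by
      rw [div_le_one (by positivity)]
      have : (0 : ℝ) ≤ n := by positivity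
      linarith
    have hFe : law d Q t F = ENNReal.ofReal (1 / ((n : ℝ) + 1)) := by
      rw [← volume_unitInterval_le hpos.le hle, ← map_edge (M := M) Q t s(none, some a)]
      exact (Measure.map_apply (f := fun ω : Sample d M => ω.2.2 s(none, some a)) (by fun_prop)
        (measurableSet_le measurable_subtype_coe measurable_const)).symm
    rw [hFe]
    simpa using hpos
  have hall := (measure_iUnion_null_iff (μ := law d Q t)).mpr hn
  rw [ae_iff]
  refine measure_mono_null ?_ hall
  intro ω hω
  simp only [Set.mem_ofPred_eq, Classical.not_imp] at hω
  obtain ⟨n, hn⟩ := exists_nat_one_div_lt (lt_of_le_of_ne (φ.nonneg v (loc a.1 (ω.2.1 a)))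
    (Ne.symm hω.2))
  simp only [Set.mem_iUnion]
  exact ⟨n, hω.1, hn.le⟩

/-- If the connection function does not vanish almost everywhere, then all large intensities fail
to be subcritical. -/
theorem exists_forall_not_isSubcritical (hd : 2 ≤ d) [MetricSpace M] [CompleteSpace M]
    [TopologicalSpace.SeparableSpace M] [BorelSpace M] (φ : ConnectionFunction d M)
    (h : ¬ ∀ᵐ w : EuclideanSpace ℝ (Fin d) × M × M ∂(volume.prod (Q.prod Q)),
      φ.toFun (0, w.2.1) (w.1, w.2.2) = 0) :
    ∃ T : ℝ≥0, ∀ t ≥ T, ¬ IsSubcritical φ Q t := by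
  obtain ⟨A, ρ, R, c, hA, hQA, hρ, hR, hc, htwo⟩ := exists_two_step φ Q h
  obtain ⟨K, hKρ'⟩ := exists_nat_gt (((d : ℝ) + 1) * 2 / ρ)
  have hKρ : ((d : ℝ) + 1) * 2 < ρ * K := by
    rw [div_lt_iff₀ hρ] at hKρ'
    linarith
  have hK : 0 < K := by
    rcases Nat.eq_zero_or_pos K with rfl | hK
    · exfalso
      simp only [Nat.cast_zero, mul_zero] at hKρ
      have : (0 : ℝ) ≤ d := by positivity
      linarith
    · exact hK
  obtain ⟨W, hWR⟩ := exists_nat_ge (R + 1)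
  have hW : 1 ≤ W := by
    have : (1 : ℝ) ≤ W := by linarith
    exact_mod_cast this
  set L : ℕ := K * (2 * W + 1) with hLdef
  have hL : 1 ≤ L := Nat.mul_pos hK (by omega)
  have hCt : (2 * L + 1 : ℝ≥0∞) ^ 4 ≠ ⊤ := by
    have : (2 * L + 1 : ℝ≥0∞) = ((2 * L + 1 : ℕ) : ℝ≥0∞) := by push_cast; rfl
    rw [this]
    exact ENNReal.pow_ne_top (ENNReal.natCast_ne_top _)
  set q : ℝ≥0∞ := 2⁻¹ / (2 * L + 1 : ℝ≥0∞) ^ 4 with hq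
  have hq0 : 0 < q := ENNReal.div_pos (by simp) hCt
  have hq' : (2 * L + 1 : ℝ≥0∞) ^ 4 * q ≤ 2⁻¹ := by
    rw [hq]; exact ENNReal.mul_div_le
  obtain ⟨m, T, hT⟩ := exists_measure_badSite_le Q hd φ hA hQA hc htwo hK hKρ hWR hq0
  refine ⟨T, fun t ht hsub => ?_⟩
  set D : Set (Sample d M) := {ω | ∀ n, ∀ i < 2 * L + 1,
    ¬ BadBox L (fun u => ω ∈ BadSite φ A K W m u) n ((i : ℕ), 0)} with hDdef
  have hDpos : 0 < law d Q t D :=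
    measure_forall_not_badBox_pos hL (P := law d Q t) coordSigma_le (iIndep_coordSigma Q t)
      (S := coordSupport d K W) (fun u v huv => disjoint_coordSupport hd hK huv)
      (fun u => measurableSet_badSite φ hA hK hW m u) (hT t ht) hq'
  have hgood0 : ∀ ω ∈ D, ω ∉ BadSite φ A K W m 0 := fun ω hω => hω 0 0 (by omega)
  obtain ⟨j, hj, hDj⟩ : ∃ j < m, law d Q t (D ∩ {ω | Candidate K A ω 0 j}) ≠ 0 := by
    by_contra! hcon
    refine hDpos.ne' (measure_mono_null ?_ ((measure_biUnion_null_iff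
      (Finset.range m).countable_toSet).mpr fun j hj => hcon j (by simpa using hj)))
    intro ω hω
    have h0 := hgood0 ω hω
    simp only [BadSite, Set.mem_union, not_or] at h0
    have h2 := h0.1.2
    simp only [Set.mem_iInter, Set.mem_compl_iff, Set.mem_ofPred_eq, Finset.mem_range,
      not_forall, not_not] at h2
    obtain ⟨j, hj, hc⟩ := h2
    simp only [Set.mem_iUnion]
    exact ⟨j, by simpa using hj, hω, hc⟩
  set a : Label d := (unitIndex d K 0, j) with ha
  set E := D ∩ {ω | Candidate K A ω 0 j} with hEdef
  -- Site events use only edges between Poisson labels, never those at the extra vertex.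
  have hsupp : ∀ u, coordSupport d K W u ⊆ {Sum.inr (Sum.inr s(none, some a))}ᶜ := by
    rintro u i (⟨z, -, rfl⟩ | ⟨b, -, rfl⟩ | ⟨b, b', -, -, rfl⟩) hi <;>
      simp at hi
  have hDm : MeasurableSet[sigmaOf M {Sum.inr (Sum.inr s(none, some a))}ᶜ] D := by
    have e : D = ⋂ n, ⋂ i ∈ Finset.range (2 * L + 1),
        {ω | BadBox L (fun u => ω ∈ BadSite φ A K W m u) n ((i : ℕ), 0)}ᶜ := by
      ext ω
      simp [hDdef]
    rw [e]
    refine MeasurableSet.iInter fun n => Finset.measurableSet_biInter _ fun i _ =>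
      MeasurableSet.compl ?_
    exact measurableSet_badBox (m := sigmaOf M {Sum.inr (Sum.inr s(none, some a))}ᶜ)
      (fun u => sigmaOf_mono (hsupp u) _ (measurableSet_badSite φ hA hK hW m u)) n _
  have hEm : MeasurableSet[sigmaOf M {Sum.inr (Sum.inr s(none, some a))}ᶜ] E :=
    hDm.inter (measurableSet_candidate hA (by simp))
  have hae : ∀ᵐ v ∂((volume : Measure (EuclideanSpace ℝ (Fin d))).prod Q),
      ∀ᵐ ω ∂(law d Q t), ω ∈ E → φ.toFun v (loc a.1 (ω.2.1 a)) = 0 := by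
    filter_upwards [hsub] with v hv
    refine measure_inter_connected_eq_zero Q φ t hv hEm ?_ ?_
    · rintro ω ⟨hω, -⟩
      have h0 := hgood0 ω hω
      simp only [BadSite, Set.mem_union, not_or] at h0
      have h1 := h0.1.1
      simp only [Set.mem_iUnion, not_exists, Set.mem_ofPred_eq, not_lt] at h1
      have := h1 _ (unitIndex_mem_window 0)
      show j < ω.1 (unitIndex d K 0)
      omega
    · rintro ω ⟨hω, hcand⟩
      exact infinite_reachable hd φ hK hW hL v hω hj hcand
  have hmeas : MeasurableSet {p : Space d M × Sample d M |
      p.2 ∈ E → φ.toFun p.1 (loc a.1 (p.2.2.1 a)) = 0} := by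
    have hf : Measurable fun p : Space d M × Sample d M => φ.toFun p.1 (loc a.1 (p.2.2.1 a)) :=
      φ.measurable.comp (measurable_fst.prodMk ((measurable_loc a.1).comp (by fun_prop)))
    have hE' : MeasurableSet E := sigmaOf_le _ _ hEm
    have e : {p : Space d M × Sample d M | p.2 ∈ E → φ.toFun p.1 (loc a.1 (p.2.2.1 a)) = 0} =
        (Prod.snd ⁻¹' E)ᶜ ∪ (fun p : Space d M × Sample d M =>
          φ.toFun p.1 (loc a.1 (p.2.2.1 a))) ⁻¹' {0} := by
      ext p
      simp [imp_iff_not_or]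
    rw [e]
    exact (measurable_snd hE').compl.union (hf (measurableSet_singleton 0))
  -- Exchanging the quantifiers yields one sample in `E` whose point `a` has `φ` zero towards almost
  -- every `v`.
  have hae' := (Measure.ae_ae_comm hmeas).mp hae
  refine hDj (measure_mono_null ?_ (ae_iff.mp hae'))
  intro ω hω hcon
  have hzero : ∀ᵐ v ∂((volume : Measure (EuclideanSpace ℝ (Fin d))).prod Q),
      φ.toFun v (loc a.1 (ω.2.1 a)) = 0 := by
    filter_upwards [hcon] with v hv using hv hω
  have hmem : (loc a.1 (ω.2.1 a) : Space d M).2 ∈ A := hω.2.2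
  -- With both points equal, the two-step bound says that the integral of `φ ^ 2` around the point
  -- is at least `c > 0`.
  have hlow := htwo _ _ hmem hmem (by simpa using hρ)
  have hint : ∫⁻ w in {w : Space d M | ‖w.1 - (loc a.1 (ω.2.1 a) : Space d M).1‖ ≤ R},
      ENNReal.ofReal (φ.toFun (loc a.1 (ω.2.1 a)) w) *
        ENNReal.ofReal (φ.toFun (loc a.1 (ω.2.1 a)) w) ∂(volume.prod Q) = 0 := by
    rw [← lintegral_zero]
    refine lintegral_congr_ae ?_
    filter_upwards [ae_restrict_of_ae hzero] with w hw
    rw [φ.symm, hw]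
    simp
  rw [hint, nonpos_iff_eq_zero, ENNReal.ofReal_eq_zero] at hlow
  linarith

/-- No monotonicity in `t` is needed, since every intensity from `T` on is excluded. -/
theorem criticalIntensity_lt_top (hd : 2 ≤ d) [MetricSpace M] [CompleteSpace M]
    [TopologicalSpace.SeparableSpace M] [BorelSpace M] (φ : ConnectionFunction d M)
    (h : ¬ ∀ᵐ w : EuclideanSpace ℝ (Fin d) × M × M ∂(volume.prod (Q.prod Q)),
      φ.toFun (0, w.2.1) (w.1, w.2.2) = 0) :
    criticalIntensity φ Q < ⊤ := by
  obtain ⟨T, hT⟩ := exists_forall_not_isSubcritical Q hd φ h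
  refine lt_of_le_of_lt (iSup₂_le fun t ht => ?_) (ENNReal.coe_lt_top (r := T))
  by_contra hlt
  rw [not_le, ENNReal.coe_lt_coe] at hlt
  exact hT t hlt.le ht

end Percolation

end MarkedRCM

/-! ### Reduction of both parts to non-vanishing of the connection function -/

theorem proposition7 {d : ℕ} (hd : 2 ≤ d) {M : Type*} [MetricSpace M] [CompleteSpace M]
    [TopologicalSpace.SeparableSpace M] [MeasurableSpace M] [BorelSpace M]
    (Q : Measure M) [IsProbabilityMeasure Q] (φ : MarkedRCM.ConnectionFunction d M) :
    (∀ (A : Set M) (φ₀ : EuclideanSpace ℝ (Fin d) → ℝ),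
      MeasurableSet A → 0 < Q A →
      Measurable φ₀ → (∀ x, 0 ≤ φ₀ x) → (∀ x, φ₀ x ≤ 1) → (∀ x, φ₀ (-x) = φ₀ x) →
      0 < ∫⁻ x, ENNReal.ofReal (φ₀ x) → ∫⁻ x, ENNReal.ofReal (φ₀ x) < ⊤ →
      (∀ᵐ w : EuclideanSpace ℝ (Fin d) × M × M ∂(volume.prod (Q.prod Q)),
        w.2.1 ∈ A → w.2.2 ∈ A → φ₀ w.1 ≤ φ.toFun (0, w.2.1) (w.1, w.2.2)) →
      MarkedRCM.criticalIntensity φ Q < ⊤) ∧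
    (0 < MarkedRCM.mixedNorm Q 1 1 (MarkedRCM.dphi φ) →
      MarkedRCM.mixedNorm Q 1 1 (MarkedRCM.dphi φ) < ⊤ →
      MarkedRCM.criticalIntensity φ Q < ⊤) := by
  have hmeas : Measurable fun w : EuclideanSpace ℝ (Fin d) × M × M =>
      φ.toFun (0, w.2.1) (w.1, w.2.2) :=
    φ.measurable.comp (by fun_prop : Measurable fun w : EuclideanSpace ℝ (Fin d) × M × M =>
      (((0, w.2.1), (w.1, w.2.2)) : MarkedRCM.Space d M × MarkedRCM.Space d M))
  refine ⟨fun A φ₀ hA hQA hφ₀ h0 _ _ hpos _ hle => ?_, fun hpos _ => ?_⟩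
  · refine MarkedRCM.criticalIntensity_lt_top Q hd φ fun hzero => ?_
    -- If `φ` vanished, the product set `{φ₀ > 0} × A × A` would be null; as `Q A > 0`, this forces
    -- `φ₀ = 0` almost everywhere.
    have h1 : ∀ᵐ w : EuclideanSpace ℝ (Fin d) × M × M ∂(volume.prod (Q.prod Q)),
        w ∉ {x | 0 < φ₀ x} ×ˢ (A ×ˢ A) := by
      filter_upwards [hzero, hle] with w hw1 hw2 hw
      have := hw2 hw.2.1 hw.2.2
      rw [hw1] at this
      exact absurd hw.1 (not_lt.mpr this)
    rw [ae_iff] at h1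
    simp only [not_not, Set.ofPred_mem_eq, Measure.prod_prod, mul_eq_zero, hQA.ne', or_self,
      or_false] at h1
    refine hpos.ne' ?_
    rw [lintegral_eq_zero_iff hφ₀.ennreal_ofReal]
    have h2 : ∀ᵐ x : EuclideanSpace ℝ (Fin d), ¬ 0 < φ₀ x := by
      rw [ae_iff]; simpa using h1
    filter_upwards [h2] with x hx
    simpa using hx
  · refine MarkedRCM.criticalIntensity_lt_top Q hd φ fun hzero => hpos.ne' ?_
    have hint : ∫⁻ w : EuclideanSpace ℝ (Fin d) × M × M,
        ENNReal.ofReal (φ.toFun (0, w.2.1) (w.1, w.2.2)) ∂(volume.prod (Q.prod Q)) = 0 := by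
      rw [lintegral_eq_zero_iff hmeas.ennreal_ofReal]
      filter_upwards [hzero] with w hw
      simp [hw]
    -- Tonelli twice, integrating over the location first, then `p`, then `q`, to match the order in
    -- the norm.
    rw [lintegral_prod_symm _ hmeas.ennreal_ofReal.aemeasurable,
      lintegral_prod_symm _ (Measurable.lintegral_prod_left'
        hmeas.ennreal_ofReal).aemeasurable] at hint
    simp only [MarkedRCM.mixedNorm, MarkedRCM.dphi, div_one, ENNReal.rpow_one]
    exact hint
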